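/- Let $k$ be a field and let $A=kQ/I$ be a brick gentle algebra. That is: $Q=(Q_0,Q_1,s,t)$ is a finite connected quiver; paths are composed from right to left; $I$ is an admissible ideal generated by a set of paths of length two; every vertex has at most two incoming and at most two outgoing arrows; for each arrow $\alpha$ there is at most one arrow $\beta$ with $s(\alpha)=t(\beta)$ and $\alpha\beta\notin I$, at most one arrow $\gamma$ with $s(\gamma)=t(\alpha)$ and $\gamma\alpha\notin I$, at most one arrow $\beta$ with $0\neq\alpha\beta\in I$, and at most one arrow $\gamma$ with $0\neq\gamma\alpha\in I$; and every finitely generated indecomposable $A$-module is a brick, i.e. its endomorphism ring is a division ring. *Strings.* A string of length $d\ge 1$ is a word $w=\gamma_d^{\epsilon_d}\cdots\gamma_1^{\epsilon_1}$ in the arrows and their formal inverses with $s(\gamma_{i+1}^{\epsilon_{i+1}})=t(\gamma_i^{\epsilon_i})$ and $\gamma_{i+1}^{\epsilon_{i+1}}\ne\gamma_i^{-\epsilon_i}$ such that neither $w$ nor $w^{-1}$ contains a subpath in $I$; there is also a string $e_i$ of length $0$ for each vertex $i$. A string is identified with its inverse, and $\operatorname{Str}(A)$ is the set of strings. A concatenation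 of strings $u,v$ is a string of the form $v\gamma^{\pm1}u$ with $\gamma\in Q_1$; if $w=v\gamma^{\pm1}u$, then $\{v,u\}$ is a break of $w$, and $v,u$ are splits of $w$. *Biclosed sets.* A set $B\subseteq\operatorname{Str}(A)$ is closed if it contains every concatenation of any two of its elements, and biclosed if $B$ and $\operatorname{Str}(A)\setminus B$ are closed. $\operatorname{Bic}(A)$ is the lattice of biclosed sets, ordered by inclusion, and $\overline{X}$ is the smallest closed set that contains $X$. *Labels.* A label $w_{\mathcal D}$ consists of a string $w$ and a set $\mathcal D$ of splits of $w$ that contains exactly one split from each break of $w$. For a label put $$J(w_{\mathcal D})=\overline{\{w\}\cup\mathcal D\cup\bigcup_{u\in\mathcal D}S(u)},$$ where $S(u)$ is the set of all splits $v$ of $u$ such that $v$ is not a split of $w$ and $v$ does not form a break of $u$ together with a string in $\mathcal D$. *Canonical join complex.* For a lattice $L$ with least element $\hat 0$, an element $j\neq\hat 0$ is join-irreducible if $j=x\vee y$ implies $j=x$ or $j=y$; $\operatorname{JI}(L)$ is the set of these. For $X\subseteq\operatorname{JI}(L)$, $x=\bigvee X$ is irredundant if no proper subset of $X$ has join $x$,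 and it is the canonical join representation of $x$ if it is irredundant and, for every irredundant $x=\bigvee Y$ with $Y\subseteq\operatorname{JI}(L)$, each $a\in X$ satisfies $a\le b$ for some $b\in Y$. The faces of the canonical join complex $\Delta^{CJ}(L)$ are the sets $X$ such that $\bigvee X$ is the canonical join representation of some element of $L$. **Theorem.** The map $w_{\mathcal D}\mapsto J(w_{\mathcal D})$ is a bijection from the set of labels onto $\operatorname{JI}(\operatorname{Bic}(A))$. For pairwise distinct labels $w^1_{\mathcal D^1},\dots,w^k_{\mathcal D^k}$, the collection $\{J(w^1_{\mathcal D^1}),\dots,J(w^k_{\mathcal D^k})\}$ is a face of $\Delta^{CJ}(\operatorname{Bic}(A))$ if and only if for all distinct $i,j\in\{1,\dots,k\}$: 1. the strings $w^i$ and $w^j$ are distinct; 2. neither $w^i$ nor $w^j$ is expressible as a concatenation of at least two strings in $J(w^i_{\mathcal D^i})\cup J(w^j_{\mathcal D^j})$; 3. neither $J(w^i_{\mathcal D^i})\subseteq J(w^j_{\mathcal D^j})$ nor $J(w^j_{\mathcal D^j})\subseteq J(w^i_{\mathcal D^i})$. -/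

import Mathlib

/-! ## Order theory: the canonical join complex

All joins are least upper bounds, so that the notions make sense in any partial order; in a lattice
they are the usual ones. -/

section OrderTheory

/-- `j` is join-irreducible: it is not the bottom element, and `j = x ∨ y` forces `j = x` or
`j = y`. -/
def IsJoinIrreducible {L : Type*} [PartialOrder L] (j : L) : Prop :=
  ¬ IsBot j ∧ ∀ x y : L, IsLUB {x, y} j → j = x ∨ j = y

/-- `x = ⋁ A`, and no proper subset of `A` has join `x`. -/
def IsIrredundantJoin {L : Type*} [PartialOrder L] (A : Set L) (x : L) : Prop :=
  IsLUB A x ∧ ∀ A' : Set L, A' ⊂ A → ¬ IsLUB A' x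

/-- `⋁ A` is the canonical join representation of `x`: an irredundant join of join-irreducibles
that refines every other such join with value `x`. -/
def IsCanonicalJoinRep {L : Type*} [PartialOrder L] (A : Set L) (x : L) : Prop :=
  (∀ a ∈ A, IsJoinIrreducible a) ∧ IsIrredundantJoin A x ∧
    ∀ B : Set L, (∀ b ∈ B, IsJoinIrreducible b) → IsIrredundantJoin B x →
      ∀ a ∈ A, ∃ b ∈ B, a ≤ b

/-- The canonical join complex: its faces are the canonical join representations of the elements
of `L`. -/
def canonicalJoinComplex (L : Type*) [PartialOrder L] : Set (Set L) :=
  {A | ∃ x : L, IsCanonicalJoinRep A x}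

end OrderTheory

/-! ## Bricks -/

section Modules

/-- A nonzero module that is not the direct sum of two nonzero submodules. -/
def IsIndecomposableModule (A M : Type*) [Ring A] [AddCommGroup M] [Module A M] : Prop :=
  Nontrivial M ∧ ∀ N P : Submodule A M, IsCompl N P → N = ⊥ ∨ P = ⊥

/-- The endomorphism ring of `M` is a division ring. -/
def IsBrick (A M : Type*) [Ring A] [AddCommGroup M] [Module A M] : Prop :=
  Nontrivial (Module.End A M) ∧ ∀ f : Module.End A M, f ≠ 0 → IsUnit f

end Modules

/-! ## Bound quivers and their algebras -/

/-- A quiver with vertex set `V` and arrow set `E`, with a set of paths of length two: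
`rel β α` says that the path `βα` (first `α`, then `β`) is one of the chosen generators of the
ideal `I`. -/
structure BoundQuiver (V E : Type*) where
  /-- the source of an arrow -/
  src : E → V
  /-- the target of an arrow -/
  tgt : E → V
  /-- the paths of length two that generate the ideal -/
  rel : E → E → Prop
  rel_comp : ∀ β α : E, rel β α → src β = tgt α

namespace BoundQuiver

variable {V E : Type*}

/-- The underlying graph of the quiver is connected (in particular nonempty). -/
def IsConnected (Q : BoundQuiver V E) : Prop :=
  Nonempty V ∧
    ∀ x y : V, Relation.EqvGen (fun u v => ∃ a : E, Q.src a = u ∧ Q.tgt a = v) x y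

/-- `(Q, I)` is a gentle bound quiver. As `I` is generated by paths of length two, a path lies in
`I` if and only if it has two consecutive arrows that form a generator; `admissible` therefore says
that `I` contains all paths of length `m`, for some `m ≥ 2`. -/
structure IsGentle (Q : BoundQuiver V E) : Prop where
  admissible : ∃ m : ℕ, 2 ≤ m ∧ ∀ p : List E, p.length = m →
    p.IsChain (fun α β => Q.src β = Q.tgt α) →
    ∃ (p₁ p₂ : List E) (α β : E), p = p₁ ++ α :: β :: p₂ ∧ Q.rel β α
  outgoing : ∀ v : V, {α : E | Q.src α = v}.encard ≤ 2
  incoming : ∀ v : V, {α : E | Q.tgt α = v}.encard ≤ 2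
  before : ∀ α : E, {β : E | Q.src α = Q.tgt β ∧ ¬ Q.rel α β}.Subsingleton
  after : ∀ α : E, {γ : E | Q.src γ = Q.tgt α ∧ ¬ Q.rel γ α}.Subsingleton
  before_rel : ∀ α : E, {β : E | Q.rel α β}.Subsingleton
  after_rel : ∀ α : E, {γ : E | Q.rel γ α}.Subsingleton

section Algebra

variable (k : Type*) [Field k] [Fintype V]

/-- The defining relations of `kQ/I` in the generators `e_v` (`v` a vertex) and `α` (an arrow):
the `e_v` are orthogonal idempotents with sum `1`, `e_{t(α)} α = α = α e_{s(α)}`, and `βα = 0` for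
the generators `βα` of `I`. -/
inductive AlgebraRel (Q : BoundQuiver V E) :
    FreeAlgebra k (V ⊕ E) → FreeAlgebra k (V ⊕ E) → Prop
  | idem (v : V) : AlgebraRel Q
      (FreeAlgebra.ι k (Sum.inl v) * FreeAlgebra.ι k (Sum.inl v)) (FreeAlgebra.ι k (Sum.inl v))
  | orth (u v : V) : u ≠ v → AlgebraRel Q
      (FreeAlgebra.ι k (Sum.inl u) * FreeAlgebra.ι k (Sum.inl v)) 0
  | one : AlgebraRel Q (∑ v : V, FreeAlgebra.ι k (Sum.inl v)) 1
  | left (α : E) : AlgebraRel Q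
      (FreeAlgebra.ι k (Sum.inl (Q.tgt α)) * FreeAlgebra.ι k (Sum.inr α))
      (FreeAlgebra.ι k (Sum.inr α))
  | right (α : E) : AlgebraRel Q
      (FreeAlgebra.ι k (Sum.inr α) * FreeAlgebra.ι k (Sum.inl (Q.src α)))
      (FreeAlgebra.ι k (Sum.inr α))
  | rel (β α : E) : Q.rel β α → AlgebraRel Q
      (FreeAlgebra.ι k (Sum.inr β) * FreeAlgebra.ι k (Sum.inr α)) 0

/-- The algebra `A = kQ/I`. -/
abbrev BoundPathAlgebra (Q : BoundQuiver V E) : Type _ := RingQuot (AlgebraRel k Q)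

end Algebra

/-- `A = kQ/I` is a brick algebra: every finitely generated indecomposable left `A`-module is a
brick. -/
def IsBrickAlgebra.{u} (k : Type u) [Field k] [Fintype V] (Q : BoundQuiver V E) : Prop :=
  ∀ (M : Type u) [AddCommGroup M] [Module (Q.BoundPathAlgebra k) M],
    Module.Finite (Q.BoundPathAlgebra k) M →
    IsIndecomposableModule (Q.BoundPathAlgebra k) M → IsBrick (Q.BoundPathAlgebra k) M

/-! ## Strings -/

/-- The source of a letter: `(α, true)` is the arrow `α` and `(α, false)` its formal inverse. -/
def lsrc (Q : BoundQuiver V E) (l : E × Bool) : V := if l.2 then Q.src l.1 else Q.tgt l.1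

/-- The target of a letter. -/
def ltgt (Q : BoundQuiver V E) (l : E × Bool) : V := if l.2 then Q.tgt l.1 else Q.src l.1

/-- The formal inverse of a letter. -/
def linv (l : E × Bool) : E × Bool := (l.1, !l.2)

/-- The letter `m` may come immediately after the letter `l` in a string: `t(l) = s(m)`,
`m ≠ l⁻¹`, and neither `ml` nor its inverse `l⁻¹m⁻¹` is a path in `I`. -/
def Follows (Q : BoundQuiver V E) (l m : E × Bool) : Prop :=
  Q.ltgt l = Q.lsrc m ∧ m ≠ linv l ∧
    ¬ (l.2 = true ∧ m.2 = true ∧ Q.rel m.1 l.1) ∧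
    ¬ (l.2 = false ∧ m.2 = false ∧ Q.rel l.1 m.1)

/-- The vertex at which the walk from `v` along the letters `ls` (in order of traversal) ends. -/
def endpt (Q : BoundQuiver V E) (v : V) (ls : List (E × Bool)) : V :=
  ls.foldl (fun _ l => Q.ltgt l) v

/-- An oriented string `γ_d^{ε_d} ⋯ γ_1^{ε_1}`: the vertex where it starts, with the list of its
letters in the order of traversal, `γ_1^{ε_1}` first. The empty list gives the lazy string at
`start`. -/
@[ext]
structure OString (Q : BoundQuiver V E) where
  /-- the vertex where the string starts -/
  start : V
  /-- the letters, in order of traversal -/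
  letters : List (E × Bool)
  start_eq : ∀ l ∈ letters.head?, Q.lsrc l = start
  chain : letters.IsChain Q.Follows

section Inverse

variable {Q : BoundQuiver V E}

theorem linv_linv (l : E × Bool) : linv (linv l) = l := by
  simp [linv]

theorem lsrc_linv (l : E × Bool) : Q.lsrc (linv l) = Q.ltgt l := by
  rcases l with ⟨a, _ | _⟩ <;> simp [linv, lsrc, ltgt]

theorem ltgt_linv (l : E × Bool) : Q.ltgt (linv l) = Q.lsrc l := by
  rcases l with ⟨a, _ | _⟩ <;> simp [linv, lsrc, ltgt]

theorem Follows.inv {l m : E × Bool} (h : Q.Follows l m) : Q.Follows (linv m) (linv l) := by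
  obtain ⟨h1, h2, h3, h4⟩ := h
  refine ⟨by rw [ltgt_linv, lsrc_linv, h1], ?_, ?_, ?_⟩
  · rw [linv_linv]
    exact fun h => h2 h.symm
  · rintro ⟨a, b, c⟩
    exact h4 ⟨by simpa [linv] using b, by simpa [linv] using a, c⟩
  · rintro ⟨a, b, c⟩
    exact h3 ⟨by simpa [linv] using b, by simpa [linv] using a, c⟩

theorem endpt_append_singleton (v : V) (ls : List (E × Bool)) (l : E × Bool) :
    Q.endpt v (ls ++ [l]) = Q.ltgt l := by
  simp [endpt]

/-- The inverse of an oriented string. -/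
def OString.inv (w : OString Q) : OString Q where
  start := Q.endpt w.start w.letters
  letters := (w.letters.map linv).reverse
  start_eq := by
    rcases List.eq_nil_or_concat w.letters with h | ⟨ls, l, h⟩
    · simp [h]
    · simp [h, endpt, lsrc_linv]
  chain := by
    rw [List.isChain_reverse, List.isChain_map]
    exact w.chain.imp fun _ _ h => h.inv

theorem OString.inv_inv (w : OString Q) : w.inv.inv = w := by
  rcases w with ⟨v, ls, h1, h2⟩
  have e : (linv ∘ linv : E × Bool → E × Bool) = id := funext linv_linv
  ext1
  · rcases ls with _ | ⟨l, ls⟩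
    · simp [OString.inv, endpt]
    · have := h1 l (by simp)
      simpa [OString.inv, endpt, ltgt_linv] using this
  · simp [OString.inv, e]

end Inverse

/-- A string is identified with its inverse. -/
instance stringSetoid (Q : BoundQuiver V E) : Setoid (OString Q) where
  r w w' := w' = w ∨ w' = w.inv
  iseqv :=
    { refl := fun _ => Or.inl rfl
      symm := by
        rintro w w' (h | h)
        · exact Or.inl h.symm
        · exact Or.inr (by rw [h, OString.inv_inv])
      trans := by
        rintro w w' w'' (h | h) (h' | h')
        · exact Or.inl (h'.trans h)
        · exact Or.inr (by rw [h', h])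
        · exact Or.inr (by rw [h', h])
        · exact Or.inl (by rw [h', h, OString.inv_inv]) }

/-- The set `Str(A)` of strings. -/
def Str (Q : BoundQuiver V E) : Type _ := Quotient (stringSetoid Q)

/-- The string in `Str(A)` given by an oriented string. -/
def OString.toStr {Q : BoundQuiver V E} (w : OString Q) : Q.Str := Quotient.mk (stringSetoid Q) w

/-- `w = v γ^{±1} u` as words, for some arrow `γ`: first `u` is traversed, then the letter `l`,
then `v`. -/
def OString.IsConcat {Q : BoundQuiver V E} (w v u : OString Q) : Prop :=
  ∃ l : E × Bool, Q.endpt u.start u.letters = Q.lsrc l ∧ Q.ltgt l = v.start ∧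
    w.start = u.start ∧ w.letters = u.letters ++ l :: v.letters

/-- The string `w` is a concatenation `v γ^{±1} u` of the strings `v` and `u` (equivalently,
`{v, u}` is a break of `w`). -/
def IsConcat (Q : BoundQuiver V E) (w v u : Q.Str) : Prop :=
  ∃ w' v' u' : OString Q, w'.toStr = w ∧ v'.toStr = v ∧ u'.toStr = u ∧ w'.IsConcat v' u'

/-- `w = u^n γ_{n-1}^{±1} u^{n-1} ⋯ γ_1^{±1} u^1` as words, with every `u^i` in `X`. -/
inductive OString.IsConcatOf {Q : BoundQuiver V E} (X : Set Q.Str) : ℕ → OString Q → Prop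
  | single (w : OString Q) : w.toStr ∈ X → IsConcatOf X 1 w
  | append (n : ℕ) (w v u : OString Q) : IsConcatOf X n u → v.toStr ∈ X → w.IsConcat v u →
      IsConcatOf X (n + 1) w

/-- The string `w` is a concatenation of at least two strings in `X`. -/
def IsProperConcatOf (Q : BoundQuiver V E) (X : Set Q.Str) (w : Q.Str) : Prop :=
  ∃ (n : ℕ) (w' : OString Q), 2 ≤ n ∧ w'.toStr = w ∧ w'.IsConcatOf X n

/-- `v` is a split of `w`: it belongs to a break of `w`. -/
def IsSplit (Q : BoundQuiver V E) (w v : Q.Str) : Prop :=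
  ∃ u : Q.Str, Q.IsConcat w v u ∨ Q.IsConcat w u v

/-! ## Biclosed sets -/

/-- A set of strings closed under concatenation. -/
def IsClosedSet (Q : BoundQuiver V E) (B : Set Q.Str) : Prop :=
  ∀ v ∈ B, ∀ u ∈ B, ∀ w : Q.Str, Q.IsConcat w v u → w ∈ B

/-- The smallest closed set that contains `X`. -/
def strClosure (Q : BoundQuiver V E) (X : Set Q.Str) : Set Q.Str :=
  {w | ∀ B : Set Q.Str, Q.IsClosedSet B → X ⊆ B → w ∈ B}

/-- The poset `Bic(A)` of biclosed sets of strings, ordered by inclusion. -/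
abbrev Bic (Q : BoundQuiver V E) : Type _ :=
  {B : Set Q.Str // Q.IsClosedSet B ∧ Q.IsClosedSet Bᶜ}

/-- A label `w_D`: a string `w` with a set `D` of splits of `w` that contains exactly one of the
two splits in each break of `w`. -/
@[ext]
structure Label (Q : BoundQuiver V E) where
  /-- the string -/
  str : Q.Str
  /-- the chosen splits -/
  splits : Set Q.Str
  isSplit : ∀ v ∈ splits, Q.IsSplit str v
  break_iff : ∀ v u : Q.Str, Q.IsConcat str v u → (v ∈ splits ↔ u ∉ splits)

/-- For `u ∈ D`, the set `S(u, D)` of all splits `v` of `u` that are not splits of `w` and that do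
not form a break of `u` together with a string in `D`. -/
def Label.interior {Q : BoundQuiver V E} (x : Q.Label) (u : Q.Str) : Set Q.Str :=
  {v | Q.IsSplit u v ∧ ¬ Q.IsSplit x.str v ∧
    ∀ z ∈ x.splits, ¬ Q.IsConcat u v z ∧ ¬ Q.IsConcat u z v}

/-- The set `J(w_D)`: the closure of the union of `{w}`, `D` and all `S(u, D)` with `u ∈ D`. -/
def Label.J {Q : BoundQuiver V E} (x : Q.Label) : Set Q.Str :=
  Q.strClosure ({x.str} ∪ x.splits ∪ ⋃ u ∈ x.splits, x.interior u)

end BoundQuiver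

/-!
Write the letters of a string `w` of length `d` in order and let `w.sub i j` be the part between
the vertices in positions `i` and `j`. The proof has an algebraic input and a combinatorial part.

*Algebra.* Over a brick algebra every string visits every vertex at most once
(`IsBrickAlgebra.selfAvoiding`). For a shortest closed string `w`, the string module of `w` (if its
end letters point in the same direction) or of `w w` without one end letter (otherwise) has an
endomorphism ring that is local with a nonzero nilpotent element. It is thus indecomposable but not
a brick. Hence `Str(A)` is finite, and a subword of a string is determined by its class in `Str(A)`
(`SelfAvoiding.sub_inj`). Nothing else about the algebra is used.

*Biclosed sets.* The closure of `X` consists of the concatenations of strings in `X`, and the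
closure of a set with closed complement has a closed complement
(`isClosedSet_compl_strClosure`). So the join in `Bic(A)` is the closure of the union.

*The sets `J(w_D)`.* The generators of `J(w_D)` are the subwords `w.sub i j` such that the end part
of `w` from `i` and the initial part up to `j` both lie in `D` or equal `w` (`Label.mem_gens_iff`).
Every break of such a subword has a part of the same form, so `J(w_D)` is biclosed, and it is the
least biclosed set that contains `w` but no split of `w` outside `D` (`Label.J_subset`).

*Concatenations with value `w`.* If `w` is a concatenation of at least two strings, then the set
`D` chooses the left or the right part at each cut between them. Where the choice first changes
from left to right there is a piece whose complement in `w` consists of one or two strings of `D`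
(`Label.exists_piece`). So condition (2) for pairs already implies that `w^i` is not a concatenation
of at least two strings of `⋃ J(w^j_{D^j})`. It follows that removing `w^i` from the join `B` of a
pairwise compatible family leaves a biclosed set, and that the splits of `w^i` in `B` are those in
`D^i` (`Label.Compatible.joinDiff`, `Label.Compatible.mem_splits_of_mem_join`). For a single label
this says that `J(w_D)` without `w` is biclosed, and by minimality `J(w_D)` is join-irreducible.
Conversely every biclosed set is the join of the sets `J(w_D)` that it contains
(`Label.isLUB_toBic`), so there are no other join-irreducible elements.

*Faces.* If `B` is the join of a compatible family, then any other family with join `B` has a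
member that contains `w^i`, since otherwise its join would lie in `B` without `w^i`. By minimality
this member contains `J(w^i_{D^i})`, which gives the canonical join representation. Conversely, in a
canonical join representation one cannot replace `J(w_D)` by `J(w_D)` without `w` and keep the join
(`Label.exists_join_of_mem_face`), and this excludes every violation of the three conditions.
-/

namespace BoundQuiver

variable {V E : Type*} {Q : BoundQuiver V E}

/-! ### Subwords of oriented strings -/

namespace OString

/-- The number of letters of an oriented string. -/
def len (w : OString Q) : ℕ := w.letters.length

/-- The vertex that an oriented string reaches after its first `n` letters. -/
def vert (w : OString Q) (n : ℕ) : V := Q.endpt w.start (w.letters.take n)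

theorem vert_zero (w : OString Q) : w.vert 0 = w.start := by
  simp [vert, endpt]

theorem vert_len (w : OString Q) : w.vert w.len = Q.endpt w.start w.letters := by
  simp [vert, len]

theorem vert_succ (w : OString Q) {n : ℕ} (h : n < w.letters.length) :
    w.vert (n + 1) = Q.ltgt w.letters[n] := by
  rw [vert, List.take_succ_eq_append_getElem h, endpt_append_singleton]

theorem lsrc_getElem (w : OString Q) {n : ℕ} (h : n < w.letters.length) :
    Q.lsrc w.letters[n] = w.vert n := by
  rcases n with _ | n
  · rw [vert_zero]
    apply w.start_eq
    rw [List.head?_eq_getElem?]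
    simp [h]
  · rw [vert_succ w (by omega)]
    have := List.isChain_iff_getElem.1 w.chain n h
    exact this.1.symm

/-- The subword of `w` that runs from the vertex in position `i` to the vertex in position `j`. -/
def sub (w : OString Q) (i j : ℕ) : OString Q where
  start := w.vert i
  letters := (w.letters.take j).drop i
  start_eq := by
    intro l hl
    rw [List.head?_drop, List.getElem?_take] at hl
    split_ifs at hl with h
    · rw [Option.mem_def, List.getElem?_eq_some_iff] at hl
      obtain ⟨h', rfl⟩ := hl
      exact lsrc_getElem w h'
    · simp at hl
  chain := (w.chain.take j).drop i

theorem len_sub (w : OString Q) {i j : ℕ} (hj : j ≤ w.len) : (w.sub i j).len = j - i := by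
  simp only [len, sub, List.length_drop, List.length_take] at *
  omega

theorem vert_sub (w : OString Q) {i j n : ℕ} (h : i + n ≤ j) (hj : j ≤ w.len) :
    (w.sub i j).vert n = w.vert (i + n) := by
  rcases n with _ | n
  · rw [vert_zero]; rfl
  · have h1 : n < (w.sub i j).letters.length := by
      have := len_sub w (i := i) hj
      simp only [len] at this
      omega
    have h2 : i + n < w.letters.length := by
      simp only [len] at hj
      omega
    rw [vert_succ _ h1, ← add_assoc, vert_succ _ h2]
    simp [sub]

theorem sub_zero_len (w : OString Q) : w.sub 0 w.len = w := by
  ext1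
  · exact vert_zero w
  · simp [sub, len]

theorem sub_sub (w : OString Q) {i j a b : ℕ} (hab : a ≤ b) (h : i + b ≤ j) (hj : j ≤ w.len) :
    (w.sub i j).sub a b = w.sub (i + a) (i + b) := by
  ext1
  · exact vert_sub w (by omega) hj
  · simp only [sub]
    rw [List.take_drop, List.drop_drop, List.take_take, min_eq_left h]

theorem isConcat_len {w v u : OString Q} (h : w.IsConcat v u) : w.len = u.len + v.len + 1 := by
  obtain ⟨l, -, -, -, h⟩ := h
  simp only [len, h, List.length_append, List.length_cons]
  omega

/-- A break of an oriented string is given by the position of the letter that is removed. -/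
theorem isConcat_iff (w v u : OString Q) :
    w.IsConcat v u ↔ ∃ e < w.len, u = w.sub 0 e ∧ v = w.sub (e + 1) w.len := by
  constructor
  · intro hc
    have hl := isConcat_len hc
    obtain ⟨l, h1, h2, h3, h4⟩ := hc
    refine ⟨u.len, by omega, ?_, ?_⟩
    · ext1
      · simp [sub, vert_zero, h3]
      · simp [sub, h4, len]
    · ext1
      · have hlt : u.letters.length < w.letters.length := by simp only [len] at hl; omega
        simp only [sub]
        rw [len, vert_succ _ hlt, ← h2]
        simp [h4]
      · simp only [sub, len]
        rw [List.take_of_length_le le_rfl, h4]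
        simp
  · rintro ⟨e, he, rfl, rfl⟩
    have he' : e < w.letters.length := he
    refine ⟨w.letters[e], ?_, ?_, ?_, ?_⟩
    · rw [lsrc_getElem, ← vert_len, len_sub _ he.le, vert_sub _ (by omega) he.le]
      simp
    · simp [sub, vert_succ _ he']
    · simp [sub, vert_zero]
    · simp [sub, len]

theorem isConcat_sub (w : OString Q) {i e j : ℕ} (hi : i ≤ e) (he : e < j) (hj : j ≤ w.len) :
    (w.sub i j).IsConcat (w.sub (e + 1) j) (w.sub i e) := by
  rw [isConcat_iff, len_sub w hj]
  refine ⟨e - i, by omega, ?_, ?_⟩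
  · rw [sub_sub w (by omega) (by omega) hj]
    congr 1; omega
  · rw [sub_sub w (by omega) (by omega) hj]
    congr 1 <;> omega

theorem IsConcat.of_sub {w v u : OString Q} {i j : ℕ} (hij : i ≤ j) (hj : j ≤ w.len)
    (h : (w.sub i j).IsConcat v u) :
    ∃ e, i ≤ e ∧ e < j ∧ u = w.sub i e ∧ v = w.sub (e + 1) j := by
  rw [isConcat_iff, len_sub w hj] at h
  obtain ⟨e, he, rfl, rfl⟩ := h
  refine ⟨i + e, by omega, by omega, ?_, ?_⟩
  · rw [sub_sub w (by omega) (by omega) hj]; rfl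
  · rw [sub_sub w (by omega) (by omega) hj]
    congr 1; omega

/-- Of two breaks of a string, the one further to the left breaks the left part of the other. -/
theorem IsConcat.interpolate {w v u v' u' : OString Q} (h : w.IsConcat v u)
    (h' : w.IsConcat v' u') (hlt : u'.len < u.len) :
    ∃ x, u.IsConcat x u' ∧ v'.IsConcat v x := by
  rw [isConcat_iff] at h h'
  obtain ⟨e, he, rfl, rfl⟩ := h
  obtain ⟨e', he', rfl, rfl⟩ := h'
  rw [len_sub _ he.le, len_sub _ he'.le] at hlt
  exact ⟨w.sub (e' + 1) e, w.isConcat_sub (by omega) (by omega) he.le,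
    w.isConcat_sub (by omega) he le_rfl⟩

theorem IsConcat.eq_of_len_eq {w v u v' u' : OString Q} (h : w.IsConcat v u)
    (h' : w.IsConcat v' u') (hlt : u'.len = u.len) : v' = v ∧ u' = u := by
  rw [isConcat_iff] at h h'
  obtain ⟨e, he, rfl, rfl⟩ := h
  obtain ⟨e', he', rfl, rfl⟩ := h'
  rw [len_sub _ he.le, len_sub _ he'.le] at hlt
  obtain rfl : e' = e := by omega
  exact ⟨rfl, rfl⟩

theorem IsConcat.assoc {w v u a b : OString Q} (h : w.IsConcat v u) (h' : v.IsConcat a b) :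
    ∃ c, w.IsConcat a c ∧ c.IsConcat b u := by
  have hl := isConcat_len h'
  rw [isConcat_iff] at h
  obtain ⟨e, he, rfl, rfl⟩ := h
  obtain ⟨e', h1, h2, rfl, rfl⟩ := IsConcat.of_sub (by omega) le_rfl h'
  refine ⟨w.sub 0 e', ?_, w.isConcat_sub (by omega) (by omega) (by omega)⟩
  have := w.isConcat_sub (i := 0) (e := e') (by omega) h2 le_rfl
  rwa [sub_zero_len] at this

theorem len_inv (w : OString Q) : w.inv.len = w.len := by
  simp [len, inv]

theorem endpt_inv (w : OString Q) : Q.endpt w.inv.start w.inv.letters = w.start := by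
  have := congrArg OString.start (inv_inv w)
  exact this

theorem IsConcat.inv {w v u : OString Q} (h : w.IsConcat v u) : w.inv.IsConcat u.inv v.inv := by
  obtain ⟨l, h1, h2, h3, h4⟩ := h
  refine ⟨linv l, ?_, ?_, ?_, ?_⟩
  · rw [endpt_inv, lsrc_linv, h2]
  · rw [ltgt_linv, ← h1]; rfl
  · simp only [OString.inv, h4, endpt, List.foldl_append, List.foldl_cons]
    rw [h2]
  · simp [OString.inv, h4]

theorem toStr_eq_iff {w w' : OString Q} : w.toStr = w'.toStr ↔ w' = w ∨ w' = w.inv :=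
  Quotient.eq (r := stringSetoid Q)

theorem toStr_inv (w : OString Q) : w.inv.toStr = w.toStr :=
  (toStr_eq_iff.2 (Or.inr rfl)).symm

theorem exists_toStr (s : Q.Str) : ∃ w : OString Q, w.toStr = s :=
  Quotient.exists_rep s

theorem IsConcat.toStr {w v u : OString Q} (h : w.IsConcat v u) :
    Q.IsConcat w.toStr v.toStr u.toStr :=
  ⟨w, v, u, rfl, rfl, rfl, h⟩

end OString

theorem IsConcat.symm {w v u : Q.Str} (h : Q.IsConcat w v u) : Q.IsConcat w u v := by
  obtain ⟨w, v, u, rfl, rfl, rfl, h⟩ := h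
  simpa only [OString.toStr_inv] using h.inv.toStr

/-- The breaks of the string of a subword `w.sub i j`. -/
theorem IsConcat.exists_of_sub {w : OString Q} {i j : ℕ} {v u : Q.Str} (hij : i ≤ j)
    (hj : j ≤ w.len) (h : Q.IsConcat (w.sub i j).toStr v u) :
    ∃ e, i ≤ e ∧ e < j ∧ ((u = (w.sub i e).toStr ∧ v = (w.sub (e + 1) j).toStr) ∨
      (v = (w.sub i e).toStr ∧ u = (w.sub (e + 1) j).toStr)) := by
  obtain ⟨w', v', u', hw, rfl, rfl, h⟩ := h
  rcases OString.toStr_eq_iff.1 hw with hw | hw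
  · subst hw
    obtain ⟨e, h1, h2, rfl, rfl⟩ := OString.IsConcat.of_sub hij hj h
    exact ⟨e, h1, h2, Or.inl ⟨rfl, rfl⟩⟩
  · have h := h.inv
    rw [← hw] at h
    obtain ⟨e, h1, h2, h3, h4⟩ := OString.IsConcat.of_sub hij hj h
    refine ⟨e, h1, h2, Or.inr ⟨?_, ?_⟩⟩
    · rw [← h3, OString.toStr_inv]
    · rw [← h4, OString.toStr_inv]

theorem IsConcat.exists_break {w : OString Q} {v u : Q.Str} (h : Q.IsConcat w.toStr v u) :
    ∃ e < w.len, (u = (w.sub 0 e).toStr ∧ v = (w.sub (e + 1) w.len).toStr) ∨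
      (v = (w.sub 0 e).toStr ∧ u = (w.sub (e + 1) w.len).toStr) := by
  rw [← w.sub_zero_len] at h
  obtain ⟨e, -, h1, h2⟩ := h.exists_of_sub (Nat.zero_le _) le_rfl
  exact ⟨e, h1, h2⟩

/-! ### Closures and biclosed sets -/

namespace OString.IsConcatOf

variable {X : Set Q.Str}

theorem one_le {n : ℕ} {w : OString Q} (h : w.IsConcatOf X n) : 1 ≤ n := by
  cases h <;> omega

theorem concat {m n : ℕ} {w v u : OString Q} (hv : v.IsConcatOf X n) (hu : u.IsConcatOf X m)
    (h : w.IsConcat v u) : w.IsConcatOf X (m + n) := by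
  induction hv generalizing w with
  | single v hv => exact .append m w v u hu hv h
  | append n v a b _ ha hab ih =>
    obtain ⟨c, h1, h2⟩ := h.assoc hab
    exact .append (m + n) w a c (ih h2) ha h1

theorem inv {n : ℕ} {w : OString Q} (h : w.IsConcatOf X n) : w.inv.IsConcatOf X n := by
  induction h with
  | single w hw => exact .single _ (by rwa [toStr_inv])
  | append n w v u _ hv h ih =>
    rw [add_comm]
    exact concat ih (.single v.inv (by rwa [toStr_inv])) h.inv

theorem mono {Y : Set Q.Str} (hXY : X ⊆ Y) {n : ℕ} {w : OString Q} (h : w.IsConcatOf X n) :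
    w.IsConcatOf Y n := by
  induction h with
  | single w hw => exact .single _ (hXY hw)
  | append n w v u _ hv h ih => exact .append n w v u ih (hXY hv) h

theorem toStr_mem {B : Set Q.Str} (hB : Q.IsClosedSet B) {n : ℕ} {w : OString Q}
    (h : w.IsConcatOf B n) : w.toStr ∈ B := by
  induction h with
  | single w hw => exact hw
  | append n w v u _ hv h ih => exact hB _ hv _ ih _ h.toStr

/-- Both an oriented string and its inverse are concatenations of strings in `X` if its class
is. -/
theorem of_toStr_eq {n : ℕ} {w w' : OString Q} (h : w.IsConcatOf X n)
    (hw : w'.toStr = w.toStr) : w'.IsConcatOf X n := by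
  rcases toStr_eq_iff.1 hw with rfl | h'
  · exact h
  · rw [← w'.inv_inv, ← h']
    exact h.inv

end OString.IsConcatOf

theorem subset_strClosure (X : Set Q.Str) : X ⊆ Q.strClosure X :=
  fun _ hw _ _ hX => hX hw

theorem strClosure_subset {X B : Set Q.Str} (hB : Q.IsClosedSet B) (h : X ⊆ B) :
    Q.strClosure X ⊆ B :=
  fun _ hw => hw B hB h

theorem isClosedSet_strClosure (X : Set Q.Str) : Q.IsClosedSet (Q.strClosure X) :=
  fun v hv u hu w h B hB hX => hB v (hv B hB hX) u (hu B hB hX) w h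

theorem mem_strClosure_iff {X : Set Q.Str} {w : OString Q} :
    w.toStr ∈ Q.strClosure X ↔ ∃ n, w.IsConcatOf X n := by
  constructor
  · intro h
    have key : Q.IsClosedSet {s | ∀ w' : OString Q, w'.toStr = s → ∃ n, w'.IsConcatOf X n} := by
      rintro v hv u hu w ⟨w', v', u', rfl, rfl, rfl, h⟩ w'' hw''
      obtain ⟨n, hn⟩ := hv v' rfl
      obtain ⟨m, hm⟩ := hu u' rfl
      exact ⟨_, (hn.concat hm h).of_toStr_eq hw''⟩
    exact h _ key (fun s hs w' hw' => ⟨1, .single w' (by rwa [hw'])⟩) w rfl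
  · rintro ⟨n, hn⟩
    exact (hn.mono (subset_strClosure X)).toStr_mem (isClosedSet_strClosure X)

theorem IsProperConcatOf.mono {X Y : Set Q.Str} (hXY : X ⊆ Y) {s : Q.Str}
    (h : Q.IsProperConcatOf X s) : Q.IsProperConcatOf Y s := by
  obtain ⟨n, w, hn, hw, h⟩ := h
  exact ⟨n, w, hn, hw, h.mono hXY⟩

theorem IsProperConcatOf.mem {B : Set Q.Str} (hB : Q.IsClosedSet B) {s : Q.Str}
    (h : Q.IsProperConcatOf B s) : s ∈ B := by
  obtain ⟨n, w, -, rfl, h⟩ := h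
  exact h.toStr_mem hB

theorem IsProperConcatOf.of_strClosure {X : Set Q.Str} {s : Q.Str}
    (h : Q.IsProperConcatOf (Q.strClosure X) s) : Q.IsProperConcatOf X s := by
  obtain ⟨n, w, hn, hw, h⟩ := h
  cases h with
  | single _ => omega
  | append n w v u hu hv hc =>
    obtain ⟨a, ha⟩ := mem_strClosure_iff.1 hv
    obtain ⟨b, hb⟩ := mem_strClosure_iff.1 (hu.toStr_mem (isClosedSet_strClosure _))
    exact ⟨b + a, w, by have := ha.one_le; have := hb.one_le; omega, hw, ha.concat hb hc⟩

theorem isProperConcatOf_of_isConcat {X : Set Q.Str} {s v u : Q.Str} (hv : v ∈ X) (hu : u ∈ X)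
    (h : Q.IsConcat s v u) : Q.IsProperConcatOf X s := by
  obtain ⟨w, v, u, hw, rfl, rfl, h⟩ := h
  exact ⟨1 + 1, w, le_rfl, hw, .append 1 _ _ _ (.single _ hu) hv h⟩

theorem isClosedSet_compl_iff {X : Set Q.Str} :
    Q.IsClosedSet Xᶜ ↔ ∀ w v u : OString Q, w.IsConcat v u → w.toStr ∈ X →
      v.toStr ∈ X ∨ u.toStr ∈ X := by
  constructor
  · intro h w v u hc hw
    by_contra! hcon
    exact h _ hcon.1 _ hcon.2 _ hc.toStr hw
  · rintro h v hv u hu w ⟨w', v', u', rfl, rfl, rfl, hc⟩ hw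
    exact (h w' v' u' hc hw).elim hv hu

theorem mem_or_mem_of_isConcat {X : Set Q.Str} (hX : Q.IsClosedSet Xᶜ) {w v u : Q.Str}
    (h : Q.IsConcat w v u) (hw : w ∈ X) : v ∈ X ∨ u ∈ X := by
  by_contra! hcon
  exact hX v hcon.1 u hcon.2 w h hw

/-- The closure of a set with closed complement again has a closed complement: a break of a
concatenation either separates the pieces or breaks one of them. -/
theorem isClosedSet_compl_strClosure {X : Set Q.Str} (hX : Q.IsClosedSet Xᶜ) :
    Q.IsClosedSet (Q.strClosure X)ᶜ := by
  rw [isClosedSet_compl_iff]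
  intro w v' u' h' hw
  obtain ⟨n, hn⟩ := mem_strClosure_iff.1 hw
  clear hw
  induction hn generalizing v' u' with
  | single w hw =>
    exact (isClosedSet_compl_iff.1 hX w v' u' h' hw).imp (fun h => subset_strClosure X h)
      fun h => subset_strClosure X h
  | append n w v u hu hv h ih =>
    have hu' := mem_strClosure_iff.2 ⟨n, hu⟩
    have hv' := subset_strClosure X hv
    rcases lt_trichotomy u'.len u.len with hlt | heq | hlt
    · obtain ⟨x, h1, h2⟩ := h.interpolate h' hlt
      refine (ih x u' h1).imp (fun hx => ?_) id
      exact isClosedSet_strClosure X _ hv' _ hx _ h2.toStr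
    · obtain ⟨rfl, rfl⟩ := h.eq_of_len_eq h' heq
      exact Or.inr hu'
    · obtain ⟨x, h1, h2⟩ := h'.interpolate h hlt
      refine (isClosedSet_compl_iff.1 hX v v' x h2 hv).imp
        (fun hx => subset_strClosure X hx) fun hx => ?_
      exact isClosedSet_strClosure X _ (subset_strClosure X hx) _ hu' _ h1.toStr

theorem isClosedSet_compl_iUnion {ι : Sort*} {B : ι → Set Q.Str}
    (hB : ∀ i, Q.IsClosedSet (B i)ᶜ) : Q.IsClosedSet (⋃ i, B i)ᶜ := by
  intro v hv u hu w h hw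
  rw [Set.mem_iUnion] at hw
  obtain ⟨i, hi⟩ := hw
  exact hB i v (fun h => hv (Set.mem_iUnion_of_mem i h)) u
    (fun h => hu (Set.mem_iUnion_of_mem i h)) w h hi

/-- The join of a family of biclosed sets is the closure of its union. -/
def joinBic (T : Set Q.Bic) : Q.Bic :=
  ⟨Q.strClosure (⋃ b : T, b.1.1), isClosedSet_strClosure _,
    isClosedSet_compl_strClosure (isClosedSet_compl_iUnion fun b => b.1.2.2)⟩

theorem isLUB_joinBic (T : Set Q.Bic) : IsLUB T (joinBic T) := by
  constructor
  · intro b hb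
    exact (Set.subset_iUnion (fun b : T => b.1.1) ⟨b, hb⟩).trans (subset_strClosure _)
  · intro c hc
    exact strClosure_subset c.2.1 (Set.iUnion_subset fun b => hc b.2)

/-! ### Self-avoiding strings -/

/-- Every string visits every vertex at most once. -/
def SelfAvoiding (Q : BoundQuiver V E) : Prop :=
  ∀ (w : OString Q) (i j : ℕ), i ≤ w.len → j ≤ w.len → w.vert i = w.vert j → i = j

/-- In a self-avoiding string, a subword is determined by its class in `Str`. -/
theorem SelfAvoiding.sub_inj (hQ : Q.SelfAvoiding) {w : OString Q} {i j i' j' : ℕ} (hij : i ≤ j)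
    (hj : j ≤ w.len) (hij' : i' ≤ j') (hj' : j' ≤ w.len)
    (h : (w.sub i j).toStr = (w.sub i' j').toStr) : i = i' ∧ j = j' := by
  have hend : ∀ {i j : ℕ}, i ≤ j → j ≤ w.len →
      Q.endpt (w.sub i j).start (w.sub i j).letters = w.vert j := by
    intro i j hij hj
    rw [← OString.vert_len, OString.len_sub _ hj, OString.vert_sub _ (by omega) hj]
    congr 1; omega
  have h1 := OString.toStr_eq_iff.1 h
  rcases h1 with h1 | h1
  · have hs : w.vert i' = w.vert i := congrArg OString.start h1
    have he : w.vert j' = w.vert j := by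
      rw [← hend hij hj, ← hend hij' hj', h1]
    exact ⟨(hQ w _ _ (by omega) (by omega) hs).symm, (hQ w _ _ hj' hj he).symm⟩
  · have hs : w.vert i' = w.vert j := by
      rw [← hend hij hj]
      exact congrArg OString.start h1
    have he : w.vert j' = w.vert i := by
      rw [← hend hij' hj', h1, OString.endpt_inv]; rfl
    have := hQ w _ _ (by omega) (by omega) hs
    have := hQ w _ _ (by omega) (by omega) he
    omega

namespace OString

/-- The set of vertices of an oriented string. -/
def vset (w : OString Q) : Set V :=
  {v | v = w.start ∨ ∃ l ∈ w.letters, v = Q.lsrc l ∨ v = Q.ltgt l}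

theorem mem_vset_iff {w : OString Q} {v : V} : v ∈ w.vset ↔ ∃ n ≤ w.len, w.vert n = v := by
  constructor
  · rintro (rfl | ⟨l, hl, h⟩)
    · exact ⟨0, Nat.zero_le _, w.vert_zero⟩
    · obtain ⟨n, hn, rfl⟩ := List.getElem_of_mem hl
      rcases h with rfl | rfl
      · exact ⟨n, hn.le, (w.lsrc_getElem hn).symm⟩
      · exact ⟨n + 1, hn, w.vert_succ hn⟩
  · rintro ⟨n, hn, rfl⟩
    rcases n with _ | n
    · exact Or.inl w.vert_zero
    · exact Or.inr ⟨w.letters[n], List.getElem_mem hn, Or.inr (w.vert_succ hn)⟩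

theorem vset_inv_subset (w : OString Q) : w.inv.vset ⊆ w.vset := by
  rintro v (rfl | ⟨l, hl, h⟩)
  · exact mem_vset_iff.2 ⟨w.len, le_rfl, w.vert_len⟩
  · simp only [inv, List.mem_reverse, List.mem_map] at hl
    obtain ⟨m, hm, rfl⟩ := hl
    rw [lsrc_linv, ltgt_linv] at h
    exact Or.inr ⟨m, hm, h.symm⟩

theorem vset_inv (w : OString Q) : w.inv.vset = w.vset := by
  refine subset_antisymm w.vset_inv_subset ?_
  have := w.inv.vset_inv_subset
  rwa [inv_inv] at this

theorem vset_eq_of_toStr_eq {w w' : OString Q} (h : w.toStr = w'.toStr) : w.vset = w'.vset := by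
  rcases toStr_eq_iff.1 h with rfl | rfl
  · rfl
  · exact w.vset_inv.symm

theorem vset_sub_subset (w : OString Q) {i j : ℕ} (hij : i ≤ j) (hj : j ≤ w.len) :
    (w.sub i j).vset ⊆ w.vset := by
  intro v hv
  rw [mem_vset_iff, len_sub w hj] at hv
  obtain ⟨n, hn, rfl⟩ := hv
  exact mem_vset_iff.2 ⟨i + n, by omega, (vert_sub w (by omega) hj).symm⟩

theorem IsConcat.vset_subset {w v u : OString Q} (h : w.IsConcat v u) :
    w.vset ⊆ v.vset ∪ u.vset := by
  obtain ⟨l, h1, h2, h3, h4⟩ := h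
  rintro x (rfl | ⟨m, hm, h⟩)
  · exact Or.inr (Or.inl h3)
  · rw [h4] at hm
    simp only [List.mem_append, List.mem_cons] at hm
    rcases hm with hm | rfl | hm
    · exact Or.inr (Or.inr ⟨m, hm, h⟩)
    · rcases h with rfl | rfl
      · exact Or.inr (mem_vset_iff.2 ⟨_, le_rfl, by rw [vert_len, h1]⟩)
      · exact Or.inl (Or.inl h2)
    · exact Or.inl (Or.inr ⟨m, hm, h⟩)

theorem IsConcatOf.vset_subset {X : Set Q.Str} {S : Set V}
    (hX : ∀ w : OString Q, w.toStr ∈ X → w.vset ⊆ S) {n : ℕ} {w : OString Q}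
    (h : w.IsConcatOf X n) : w.vset ⊆ S := by
  induction h with
  | single w hw => exact hX w hw
  | append n w v u _ hv h ih => exact h.vset_subset.trans (Set.union_subset (hX v hv) ih)

/-- A string properly extending the string `w` leaves the vertex set of `w`. -/
theorem IsConcat.not_vset_subset (hQ : Q.SelfAvoiding) {w v u : OString Q}
    (h : w.IsConcat v u) : ¬ w.vset ⊆ u.vset := by
  intro hsub
  rw [isConcat_iff] at h
  obtain ⟨e, he, rfl, -⟩ := h
  have h1 := hsub (mem_vset_iff.2 ⟨e + 1, he, rfl⟩)
  rw [mem_vset_iff, len_sub w he.le] at h1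
  obtain ⟨n, hn, h1⟩ := h1
  rw [vert_sub w (by omega) he.le] at h1
  have := hQ w _ _ (by omega) (by omega) h1
  omega

end OString

theorem SelfAvoiding.ne_of_isConcat (hQ : Q.SelfAvoiding) {w v u : Q.Str}
    (h : Q.IsConcat w v u) : w ≠ u := by
  obtain ⟨w, v, u, rfl, rfl, rfl, h⟩ := h
  exact fun he => h.not_vset_subset hQ (OString.vset_eq_of_toStr_eq he).subset

/-! ### The generators of `J(w_D)` -/

namespace Label

/-- The strings whose closure is `J(w_D)`. -/
def gens (x : Q.Label) : Set Q.Str := {x.str} ∪ x.splits ∪ ⋃ u ∈ x.splits, x.interior u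

variable {x : Q.Label} {w : OString Q}

theorem isConcat_str (hw : w.toStr = x.str) {e : ℕ} (he : e < w.len) :
    Q.IsConcat x.str (w.sub (e + 1) w.len).toStr (w.sub 0 e).toStr := by
  have := w.isConcat_sub (Nat.zero_le e) he le_rfl
  rw [OString.sub_zero_len] at this
  rw [← hw]
  exact this.toStr

theorem mem_splits_iff (hw : w.toStr = x.str) {e : ℕ} (he : e < w.len) :
    (w.sub 0 e).toStr ∈ x.splits ↔ (w.sub (e + 1) w.len).toStr ∉ x.splits :=
  x.break_iff _ _ (isConcat_str hw he).symm

theorem exists_of_isSplit (hw : w.toStr = x.str) {v : Q.Str} (h : Q.IsSplit x.str v) :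
    ∃ e < w.len, v = (w.sub 0 e).toStr ∨ v = (w.sub (e + 1) w.len).toStr := by
  rw [← hw] at h
  obtain ⟨u, h⟩ := h
  have h : Q.IsConcat w.toStr v u := h.elim id IsConcat.symm
  obtain ⟨e, he, h⟩ := h.exists_break
  refine ⟨e, he, ?_⟩
  tauto

theorem str_notMem_splits (hQ : Q.SelfAvoiding) : x.str ∉ x.splits := by
  intro h
  obtain ⟨u, h⟩ := x.isSplit _ h
  exact hQ.ne_of_isConcat (h.elim IsConcat.symm id) rfl

theorem eq_or_eq_of_isSplit_sub (hQ : Q.SelfAvoiding) (hw : w.toStr = x.str) {i j : ℕ}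
    (hij : i ≤ j) (hj : j ≤ w.len) (h : Q.IsSplit x.str (w.sub i j).toStr) :
    i = 0 ∨ j = w.len := by
  obtain ⟨e, he, h | h⟩ := exists_of_isSplit hw h
  · exact Or.inl (hQ.sub_inj hij hj (Nat.zero_le _) he.le h).1
  · exact Or.inr (hQ.sub_inj hij hj he le_rfl h).2

/-- The generators of `J(w_D)` are the subwords of `w` between two cuts (or ends of `w`) such that
at the left cut `D` contains the right split, and at the right cut `D` contains the left split. -/
theorem mem_gens_iff (hQ : Q.SelfAvoiding) (hw : w.toStr = x.str) {s : Q.Str} :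
    s ∈ x.gens ↔ ∃ i j, i ≤ j ∧ j ≤ w.len ∧ s = (w.sub i j).toStr ∧
      (i = 0 ∨ (w.sub i w.len).toStr ∈ x.splits) ∧
      (j = w.len ∨ (w.sub 0 j).toStr ∈ x.splits) := by
  constructor
  · rintro ((rfl | hs) | hs)
    · exact ⟨0, w.len, Nat.zero_le _, le_rfl, by rw [OString.sub_zero_len, hw], Or.inl rfl,
        Or.inl rfl⟩
    · obtain ⟨e, he, rfl | rfl⟩ := exists_of_isSplit hw (x.isSplit s hs)
      · exact ⟨0, e, Nat.zero_le _, he.le, rfl, Or.inl rfl, Or.inr hs⟩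
      · exact ⟨e + 1, w.len, he, le_rfl, rfl, Or.inr hs, Or.inl rfl⟩
    · simp only [Set.mem_iUnion] at hs
      obtain ⟨u, hu, ⟨z, hz⟩, hns, hD⟩ := hs
      have hz : Q.IsConcat u s z := hz.elim id IsConcat.symm
      obtain ⟨e, he, rfl | rfl⟩ := exists_of_isSplit hw (x.isSplit u hu)
      · obtain ⟨f, -, hf, ⟨rfl, rfl⟩ | ⟨rfl, rfl⟩⟩ := hz.exists_of_sub (Nat.zero_le _) he.le
        · refine ⟨f + 1, e, hf, he.le, rfl, Or.inr ?_, Or.inr hu⟩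
          by_contra hcon
          exact (hD _ ((mem_splits_iff hw (hf.trans he)).2 hcon)).1 hz
        · exact absurd ⟨_, Or.inr (isConcat_str hw (hf.trans he))⟩ hns
      · obtain ⟨f, hf0, hf, ⟨rfl, rfl⟩ | ⟨rfl, rfl⟩⟩ := hz.exists_of_sub he le_rfl
        · exact absurd ⟨_, Or.inl (isConcat_str hw hf)⟩ hns
        · refine ⟨e + 1, f, hf0, hf.le, rfl, Or.inr hu, Or.inr ?_⟩
          rw [mem_splits_iff hw hf]
          exact fun hcon => (hD _ hcon).1 hz
  · rintro ⟨i, j, hij, hj, rfl, hi, hj'⟩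
    rcases Nat.eq_zero_or_pos i with rfl | hi0
    · rcases hj' with rfl | hj'
      · exact Or.inl (Or.inl (by rw [OString.sub_zero_len, hw]; rfl))
      · exact Or.inl (Or.inr hj')
    · replace hi := hi.resolve_left hi0.ne'
      rcases hj.eq_or_lt with rfl | hjl
      · exact Or.inl (Or.inr hi)
      · replace hj' := hj'.resolve_left hjl.ne
        refine Or.inr (Set.mem_iUnion₂.2 ⟨_, hj', ?_, ?_, ?_⟩)
        · obtain ⟨i, rfl⟩ : ∃ i', i = i' + 1 := ⟨i - 1, by omega⟩
          exact ⟨_, Or.inl (w.isConcat_sub (Nat.zero_le i) hij hj).toStr⟩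
        · intro h
          have := eq_or_eq_of_isSplit_sub hQ hw hij hj h
          omega
        · have key : ∀ z ∈ x.splits, ¬ Q.IsConcat (w.sub 0 j).toStr (w.sub i j).toStr z := by
            intro z hz hc
            obtain ⟨f, -, hf, ⟨rfl, h⟩ | ⟨h, -⟩⟩ := hc.exists_of_sub (Nat.zero_le _) hj
            · obtain ⟨rfl, -⟩ := hQ.sub_inj hij hj hf hj h
              exact (mem_splits_iff hw (by omega)).1 hz hi
            · have := hQ.sub_inj hij hj (Nat.zero_le _) (by omega) h
              omega
          exact fun z hz => ⟨key z hz, fun hc => key z hz hc.symm⟩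

theorem isClosedSet_compl_gens (hQ : Q.SelfAvoiding) (x : Q.Label) :
    Q.IsClosedSet x.gensᶜ := by
  obtain ⟨w, hw⟩ := OString.exists_toStr x.str
  intro v hv u hu s hc hs
  obtain ⟨i, j, hij, hj, rfl, hi, hj'⟩ := (mem_gens_iff hQ hw).1 hs
  have key : ∀ e, i ≤ e → e < j →
      (w.sub i e).toStr ∈ x.gens ∨ (w.sub (e + 1) j).toStr ∈ x.gens := by
    intro e hie hej
    by_cases h : (w.sub 0 e).toStr ∈ x.splits
    · exact Or.inl ((mem_gens_iff hQ hw).2 ⟨i, e, hie, by omega, rfl, hi, Or.inr h⟩)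
    · rw [mem_splits_iff hw (by omega), not_not] at h
      exact Or.inr ((mem_gens_iff hQ hw).2 ⟨e + 1, j, hej, hj, rfl, Or.inr h, hj'⟩)
  obtain ⟨e, hie, hej, ⟨rfl, rfl⟩ | ⟨rfl, rfl⟩⟩ := hc.exists_of_sub hij hj
  · exact (key e hie hej).elim hu hv
  · exact (key e hie hej).elim hv hu

/-- `J(w_D)` as an element of `Bic(A)`. -/
def toBic (hQ : Q.SelfAvoiding) (x : Q.Label) : Q.Bic :=
  ⟨x.J, isClosedSet_strClosure _, isClosedSet_compl_strClosure (isClosedSet_compl_gens hQ x)⟩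

theorem str_mem_J (x : Q.Label) : x.str ∈ x.J :=
  subset_strClosure _ (Or.inl (Or.inl rfl))

theorem splits_subset_J (x : Q.Label) : x.splits ⊆ x.J :=
  fun _ h => subset_strClosure _ (Or.inl (Or.inr h))

/-- `J(w_D)` is the least biclosed set that contains `w` and whose splits of `w` lie in `D`. -/
theorem J_subset (hQ : Q.SelfAvoiding) {B : Set Q.Str} (hB : Q.IsClosedSet B)
    (hB' : Q.IsClosedSet Bᶜ) (hx : x.str ∈ B)
    (hD : ∀ v ∈ B, Q.IsSplit x.str v → v ∈ x.splits) : x.J ⊆ B := by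
  obtain ⟨w, hw⟩ := OString.exists_toStr x.str
  refine strClosure_subset hB ?_
  have hDB : x.splits ⊆ B := by
    intro v hv
    have hs := x.isSplit v hv
    obtain ⟨u, hu⟩ := hs
    have hu : Q.IsConcat x.str v u := hu.elim id IsConcat.symm
    refine (mem_or_mem_of_isConcat hB' hu hx).elim id fun h => ?_
    exact absurd (hD u h ⟨v, Or.inr hu⟩) ((x.break_iff v u hu).1 hv)
  intro s hs
  obtain ⟨i, j, hij, hj, rfl, hi, hj'⟩ := (mem_gens_iff hQ hw).1 hs
  have h0 : (w.sub 0 j).toStr ∈ B := by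
    rcases hj' with rfl | h
    · rwa [OString.sub_zero_len, hw]
    · exact hDB h
  rcases i with _ | i
  · exact h0
  · have hi := hi.resolve_left (Nat.succ_ne_zero i)
    refine (mem_or_mem_of_isConcat hB' (w.isConcat_sub (Nat.zero_le i) hij hj).toStr h0).elim
      id fun h => ?_
    have hc := isConcat_str hw (show i < w.len by omega)
    exact absurd hi ((x.break_iff _ _ hc.symm).1 (hD _ h ⟨_, Or.inr hc⟩))

/-! ### Concatenations with value `w` -/

/-- If the string `w` of a label is a concatenation of at least two strings, then one of these
pieces is complemented in `w` by strings of `D`: reading the cuts between the pieces from left to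
right, with `D` taken to choose the left side at the left end of `w` and the right side at the
right end, there is a first cut where it chooses the right side. -/
theorem exists_piece (hw : w.toStr = x.str) {X : Set Q.Str} {n : ℕ} (hn : 2 ≤ n)
    (h : w.IsConcatOf X n) :
    ∃ i j, i ≤ j ∧ j ≤ w.len ∧ (w.sub i j).toStr ∈ X ∧
      (∀ e, i = e + 1 → (w.sub 0 e).toStr ∈ x.splits) ∧
      (j < w.len → (w.sub (j + 1) w.len).toStr ∈ x.splits) ∧ (i = 0 → j < w.len) := by
  have aux : ∀ (n : ℕ) (p : OString Q), p.IsConcatOf X n → ∀ c < w.len, p = w.sub 0 c →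
      (w.sub (c + 1) w.len).toStr ∈ x.splits →
      ∃ i j, i ≤ j ∧ j ≤ w.len ∧ (w.sub i j).toStr ∈ X ∧
        (∀ e, i = e + 1 → (w.sub 0 e).toStr ∈ x.splits) ∧
        (j < w.len → (w.sub (j + 1) w.len).toStr ∈ x.splits) ∧ (i = 0 → j < w.len) := by
    intro n p hp
    induction hp with
    | single p hp =>
      rintro c hc rfl hD
      exact ⟨0, c, Nat.zero_le _, hc.le, hp, fun e he => by omega, fun _ => hD, fun _ => hc⟩
    | append n p v u _ hv h ih =>
      rintro c hc rfl hD
      obtain ⟨e, -, hec, rfl, rfl⟩ := h.of_sub (Nat.zero_le _) hc.le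
      by_cases hR : (w.sub 0 e).toStr ∈ x.splits
      · refine ⟨e + 1, c, hec, hc.le, hv, fun e' he' => ?_, fun _ => hD, fun h => by omega⟩
        obtain rfl : e = e' := by omega
        exact hR
      · rw [mem_splits_iff hw (by omega), not_not] at hR
        exact ih e (by omega) rfl hR
  cases h with
  | single _ => omega
  | append n w v u hu hv h =>
    obtain ⟨e, he, rfl, rfl⟩ := (OString.isConcat_iff _ _ _).1 h
    by_cases hR : (w.sub 0 e).toStr ∈ x.splits
    · refine ⟨e + 1, w.len, he, le_rfl, hv, fun e' he' => ?_, fun h => by omega,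
        fun h => by omega⟩
      obtain rfl : e = e' := by omega
      exact hR
    · rw [mem_splits_iff hw he, not_not] at hR
      exact aux n _ hu e he rfl hR

theorem exists_isProperConcatOf {X : Set Q.Str} (h : Q.IsProperConcatOf X x.str) :
    ∃ g ∈ X, Q.IsProperConcatOf (insert g x.splits) x.str := by
  obtain ⟨n, w, hn, hw, h⟩ := h
  obtain ⟨i, j, hij, hj, hX, hl, hr, h0⟩ := exists_piece hw hn h
  refine ⟨_, hX, ?_⟩
  set g := (w.sub i j).toStr with hg
  have hg : (w.sub i j).IsConcatOf (insert g x.splits) 1 := .single _ (Or.inl rfl)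
  have hpre : ∃ m, (w.sub 0 j).IsConcatOf (insert g x.splits) m ∧ (i ≠ 0 → 2 ≤ m) := by
    rcases i with _ | e
    · exact ⟨1, hg, fun h => absurd rfl h⟩
    · exact ⟨1 + 1, .append 1 _ _ _ (.single _ (Or.inr (hl e rfl))) (Or.inl rfl)
        (w.isConcat_sub (Nat.zero_le e) hij hj), fun _ => le_rfl⟩
  obtain ⟨m, hm, hm2⟩ := hpre
  rcases hj.eq_or_lt with rfl | hlt
  · rw [OString.sub_zero_len] at hm
    exact ⟨m, w, hm2 fun h => (h0 h).ne rfl, hw, hm⟩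
  · have hc := w.isConcat_sub (Nat.zero_le j) hlt le_rfl
    rw [OString.sub_zero_len] at hc
    exact ⟨m + 1, w, by have := hm.one_le; omega, hw, .append m _ _ _ hm (Or.inr (hr hlt)) hc⟩

/-- `w` is not a concatenation of at least two strings of `J(w_D)`. -/
theorem not_isProperConcatOf_J (hQ : Q.SelfAvoiding) (x : Q.Label) :
    ¬ Q.IsProperConcatOf x.J x.str := by
  intro h
  obtain ⟨n, w, hn, hw, h⟩ := h.of_strClosure
  obtain ⟨i, j, hij, hj, hg, hl, hr, h0⟩ := exists_piece hw hn h
  obtain ⟨i', j', hij', hj', he, hi', hj''⟩ := (mem_gens_iff hQ hw).1 hg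
  obtain ⟨rfl, rfl⟩ := hQ.sub_inj hij hj hij' hj' he
  rcases i with _ | e
  · have hlt := h0 rfl
    exact (mem_splits_iff hw hlt).1 (hj''.resolve_left hlt.ne) (hr hlt)
  · exact (mem_splits_iff hw (by omega)).1 (hl e rfl) (hi'.resolve_left (Nat.succ_ne_zero e))

/-- If a closed set contains `D`, but `w` is not a concatenation of at least two of its strings,
then its splits of `w` are the strings in `D`. -/
theorem mem_splits_of_isSplit {B : Set Q.Str} (hD : x.splits ⊆ B)
    (h : ¬ Q.IsProperConcatOf B x.str) {v : Q.Str} (hv : v ∈ B) (hs : Q.IsSplit x.str v) :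
    v ∈ x.splits := by
  obtain ⟨u, hu⟩ := hs
  have hu : Q.IsConcat x.str v u := hu.elim id IsConcat.symm
  by_contra hcon
  have hu' : u ∈ x.splits := by
    by_contra h
    exact hcon ((x.break_iff v u hu).2 h)
  exact h (isProperConcatOf_of_isConcat hv (hD hu') hu)

end Label

end BoundQuiver

/-! ### Joins of join-irreducible elements -/

theorem IsJoinIrreducible.mem_of_isLUB {L : Type*} [PartialOrder L]
    (hL : ∀ T : Set L, ∃ x, IsLUB T x) {j : L} (hj : IsJoinIrreducible j) {T : Set L}
    (hT : T.Finite) (h : IsLUB T j) : j ∈ T := by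
  induction T, hT using Set.Finite.induction_on with
  | empty => exact absurd (isLUB_empty_iff.1 h) hj.1
  | @insert a T _ _ ih =>
    obtain ⟨c, hc⟩ := hL T
    have h2 : IsLUB {a, c} j := by
      refine ⟨?_, fun d hd => h.2 ?_⟩
      · rintro b (rfl | rfl)
        · exact h.1 (Or.inl rfl)
        · exact hc.2 fun t ht => h.1 (Or.inr ht)
      · rintro b (rfl | hb)
        · exact hd (Or.inl rfl)
        · exact (hc.1 hb).trans (hd (Or.inr rfl))
    rcases hj.2 a c h2 with rfl | rfl
    · exact Or.inl rfl
    · exact Or.inr (ih hc)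

theorem exists_isIrredundantJoin {L : Type*} [PartialOrder L] [Finite L] {T : Set L} {x : L}
    (h : IsLUB T x) : ∃ Y ⊆ T, IsIrredundantJoin Y x := by
  obtain ⟨Y, ⟨hY, hYx⟩, hmin⟩ := (Set.toFinite {Y : Set L | Y ⊆ T ∧ IsLUB Y x}).exists_minimal
    ⟨T, subset_rfl, h⟩
  refine ⟨Y, hY, hYx, fun A hA hAx => ?_⟩
  exact hA.2 (hmin ⟨hA.1.trans hY, hAx⟩ hA.1)

namespace BoundQuiver

variable {V E : Type*} {Q : BoundQuiver V E}

/-! ### Joins of compatible families of labels -/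

namespace Label

theorem vset_subset_of_mem_J (hQ : Q.SelfAvoiding) {x : Q.Label} {w p : OString Q}
    (hw : w.toStr = x.str) (hp : p.toStr ∈ x.J) : p.vset ⊆ w.vset := by
  obtain ⟨n, hn⟩ := mem_strClosure_iff.1 hp
  refine hn.vset_subset fun q hq => ?_
  obtain ⟨i, j, hij, hj, he, -⟩ := (mem_gens_iff hQ hw).1 hq
  rw [OString.vset_eq_of_toStr_eq he]
  exact w.vset_sub_subset hij hj

/-- The pairwise condition that characterizes the faces of the canonical join complex, stated
without its redundant part. -/
def Compatible (F : Set Q.Label) : Prop :=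
  ∀ x ∈ F, ∀ y ∈ F, x ≠ y → ¬ Q.IsProperConcatOf (x.J ∪ y.J) x.str ∧ ¬ x.J ⊆ y.J

/-- The closure of the union of the sets `J(w_D)` of a family of labels. -/
def join (F : Set Q.Label) : Set Q.Str := Q.strClosure (⋃ y ∈ F, y.J)

theorem isClosedSet_compl_join (hQ : Q.SelfAvoiding) (F : Set Q.Label) :
    Q.IsClosedSet (join F)ᶜ :=
  isClosedSet_compl_strClosure <| isClosedSet_compl_iUnion fun y =>
    isClosedSet_compl_iUnion fun _ => (y.toBic hQ).2.2

theorem J_subset_join {F : Set Q.Label} {x : Q.Label} (hx : x ∈ F) : x.J ⊆ join F :=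
  (Set.subset_biUnion_of_mem (u := fun y : Q.Label => y.J) hx).trans (subset_strClosure _)

theorem join_singleton (x : Q.Label) : join {x} = x.J := by
  refine subset_antisymm (strClosure_subset (isClosedSet_strClosure _) ?_)
    (J_subset_join rfl)
  simp

theorem compatible_singleton (x : Q.Label) : Compatible {x} := by
  rintro _ rfl _ rfl h
  exact absurd rfl h

namespace Compatible

variable {F : Set Q.Label} {x : Q.Label}

theorem not_isProperConcatOf_join (hQ : Q.SelfAvoiding) (hF : Compatible F) (hx : x ∈ F) :
    ¬ Q.IsProperConcatOf (join F) x.str := by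
  intro h
  obtain ⟨g, hg, h⟩ := exists_isProperConcatOf h.of_strClosure
  rw [Set.mem_iUnion₂] at hg
  obtain ⟨y, hy, hg⟩ := hg
  have hsub : insert g x.splits ⊆ x.J ∪ y.J :=
    Set.insert_subset (Or.inr hg) fun v hv => Or.inl (splits_subset_J x hv)
  by_cases hxy : x = y
  · subst hxy
    rw [Set.union_self] at hsub
    exact not_isProperConcatOf_J hQ x (h.mono hsub)
  · exact (hF x hx y hy hxy).1 (h.mono hsub)

theorem mem_splits_of_mem_join (hQ : Q.SelfAvoiding) (hF : Compatible F) (hx : x ∈ F)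
    {v : Q.Str} (hv : v ∈ join F) (hs : Q.IsSplit x.str v) : v ∈ x.splits :=
  mem_splits_of_isSplit ((splits_subset_J x).trans (J_subset_join hx))
    (hF.not_isProperConcatOf_join hQ hx) hv hs

theorem eq_of_str_mem_J (hQ : Q.SelfAvoiding) (hF : Compatible F) (hx : x ∈ F) {y : Q.Label}
    (hy : y ∈ F) (h : x.str ∈ y.J) : x = y := by
  by_contra hxy
  exact (hF x hx y hy hxy).2 <| J_subset hQ (y.toBic hQ).2.1 (y.toBic hQ).2.2 h
    fun v hv hs => hF.mem_splits_of_mem_join hQ hx (J_subset_join hy hv) hs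

/-- A string of the join that extends `w` is a concatenation whose cuts do not lie inside `w`, so
what extends `w` belongs to the join as well. -/
theorem mem_join_of_isConcat (hQ : Q.SelfAvoiding) (hF : Compatible F) (hx : x ∈ F)
    {s v : Q.Str} (hs : s ∈ join F) (h : Q.IsConcat s v x.str) : v ∈ join F := by
  obtain ⟨p, v, w, rfl, rfl, hw, h⟩ := h
  obtain ⟨n, hn⟩ := mem_strClosure_iff.1 hs
  clear hs
  induction hn generalizing v w with
  | single p hp =>
    rw [Set.mem_iUnion₂] at hp
    obtain ⟨y, hy, hp⟩ := hp
    refine (mem_or_mem_of_isConcat (y.toBic hQ).2.2 h.toStr hp).elim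
      (fun h => J_subset_join hy h) fun hwy => ?_
    rw [hw] at hwy
    obtain rfl := hF.eq_of_str_mem_J hQ hx hy hwy
    exact absurd (vset_subset_of_mem_J hQ hw hp) (h.not_vset_subset hQ)
  | append n p a b hb ha hp ih =>
    have ha' : a.toStr ∈ join F := subset_strClosure _ ha
    rcases lt_trichotomy w.len b.len with hlt | heq | hlt
    · obtain ⟨y, h1, h2⟩ := hp.interpolate h hlt
      exact isClosedSet_strClosure _ _ ha' _ (ih _ _ hw h1) _ h2.toStr
    · obtain ⟨rfl, -⟩ := hp.eq_of_len_eq h heq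
      exact ha'
    · obtain ⟨y, h1, h2⟩ := h.interpolate hp hlt
      rw [Set.mem_iUnion₂] at ha
      obtain ⟨z, hz, ha⟩ := ha
      refine (mem_or_mem_of_isConcat (z.toBic hQ).2.2 h2.toStr ha).elim
        (fun h => J_subset_join hz h) fun hy => ?_
      refine absurd ?_ (hF.not_isProperConcatOf_join hQ hx)
      rw [← hw]
      exact isProperConcatOf_of_isConcat (J_subset_join hz hy)
        (mem_strClosure_iff.2 ⟨n, hb⟩) h1.toStr

/-- The join of a compatible family of labels without the string of one of them, as an element of
`Bic(A)`. -/
def joinDiff (hQ : Q.SelfAvoiding) (hF : Compatible F) (hx : x ∈ F) : Q.Bic := by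
  refine ⟨join F \ {x.str}, ?_, ?_⟩
  · intro v hv u hu s hs
    refine ⟨isClosedSet_strClosure _ _ hv.1 _ hu.1 _ hs, ?_⟩
    rintro rfl
    exact hF.not_isProperConcatOf_join hQ hx (isProperConcatOf_of_isConcat hv.1 hu.1 hs)
  · have key : ∀ s v u : Q.Str, Q.IsConcat s v u → s ∈ join F → u ∈ join F →
        v ∈ join F \ {x.str} ∨ u ∈ join F \ {x.str} := by
      intro s v u hc hs hu
      by_cases hux : u = x.str
      · subst hux
        refine Or.inl ⟨hF.mem_join_of_isConcat hQ hx hs hc, ?_⟩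
        rintro rfl
        obtain ⟨p, v, w, rfl, hv, hw, h⟩ := hc
        have h2 := h.vset_subset
        rw [OString.vset_eq_of_toStr_eq (hv.trans hw.symm), Set.union_self] at h2
        exact h.not_vset_subset hQ h2
      · exact Or.inr ⟨hu, hux⟩
    intro v hv u hu s hc hs
    rcases mem_or_mem_of_isConcat (isClosedSet_compl_join hQ F) hc hs.1 with h | h
    · exact (key s u v hc.symm hs.1 h).elim hu hv
    · exact (key s v u hc hs.1 h).elim hv hu

end Compatible

/-! ### The join-irreducible elements of `Bic(A)` -/

/-- The set `J(w_D)` without `w`; it is the unique element of `Bic(A)` covered by `J(w_D)`. -/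
def lower (hQ : Q.SelfAvoiding) (x : Q.Label) : Q.Bic :=
  (compatible_singleton x).joinDiff hQ rfl

theorem coe_lower (hQ : Q.SelfAvoiding) (x : Q.Label) : (x.lower hQ).1 = x.J \ {x.str} := by
  change join {x} \ {x.str} = _
  rw [join_singleton]

theorem not_toBic_le_lower (hQ : Q.SelfAvoiding) (x : Q.Label) :
    ¬ x.toBic hQ ≤ x.lower hQ := by
  intro h
  have h2 : x.str ∈ (x.lower hQ).1 := h (str_mem_J x)
  rw [coe_lower] at h2
  exact h2.2 rfl

theorem mem_splits_of_mem_J (hQ : Q.SelfAvoiding) {x : Q.Label} {v : Q.Str} (hv : v ∈ x.J)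
    (hs : Q.IsSplit x.str v) : v ∈ x.splits :=
  mem_splits_of_isSplit (splits_subset_J x) (not_isProperConcatOf_J hQ x) hv hs

theorem le_lower_of_lt (hQ : Q.SelfAvoiding) {x : Q.Label} {c : Q.Bic} (hc : c ≤ x.toBic hQ)
    (hne : c ≠ x.toBic hQ) : c ≤ x.lower hQ := by
  change c.1 ⊆ (x.lower hQ).1
  rw [coe_lower]
  refine fun s hs => ⟨hc hs, ?_⟩
  rintro rfl
  exact hne (le_antisymm hc (J_subset hQ c.2.1 c.2.2 hs fun v hv hsp =>
    mem_splits_of_mem_J hQ (hc hv) hsp))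

theorem isJoinIrreducible_toBic (hQ : Q.SelfAvoiding) (x : Q.Label) :
    IsJoinIrreducible (x.toBic hQ) := by
  refine ⟨fun h => not_toBic_le_lower hQ x (h _), fun a b hab => ?_⟩
  by_contra! hcon
  refine not_toBic_le_lower hQ x (hab.2 ?_)
  rintro c (rfl | rfl)
  · exact le_lower_of_lt hQ (hab.1 (Or.inl rfl)) hcon.1.symm
  · exact le_lower_of_lt hQ (hab.1 (Or.inr rfl)) hcon.2.symm

theorem J_injective (hQ : Q.SelfAvoiding) : Function.Injective (Label.J (Q := Q)) := by
  have hsub : ∀ x y : Q.Label, x.J = y.J → x.str = y.str ∧ x.splits ⊆ y.splits := by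
    intro x y h
    have hle : x.lower hQ ≤ y.lower hQ := by
      refine le_lower_of_lt hQ ?_ ?_
      · change (x.lower hQ).1 ⊆ y.J
        rw [coe_lower, ← h]
        exact Set.sdiff_subset
      · intro he
        refine not_toBic_le_lower hQ x ?_
        rw [he]
        exact h.le
    have hstr : x.str = y.str := by
      by_contra hne
      have h1 : y.str ∈ (x.lower hQ).1 := by
        rw [coe_lower, h]
        exact ⟨str_mem_J y, Ne.symm hne⟩
      have h2 := hle h1
      change y.str ∈ (y.lower hQ).1 at h2
      rw [coe_lower] at h2
      exact h2.2 rfl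
    refine ⟨hstr, fun v hv => ?_⟩
    refine mem_splits_of_mem_J hQ (h ▸ splits_subset_J x hv) ?_
    rw [← hstr]
    exact x.isSplit v hv
  intro x y h
  exact Label.ext (hsub x y h).1
    (subset_antisymm (hsub x y h).2 (hsub y x h.symm).2)

/-- A string of a biclosed set `B` of which no break lies in `B` has, with its splits in `B`, a
label whose set `J` is contained in `B`. -/
theorem exists_label (hQ : Q.SelfAvoiding) {B : Set Q.Str} (hB : Q.IsClosedSet B)
    (hB' : Q.IsClosedSet Bᶜ) {s : Q.Str} (hs : s ∈ B)
    (h : ∀ v u, Q.IsConcat s v u → v ∈ B → u ∉ B) :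
    ∃ x : Q.Label, x.str = s ∧ x.J ⊆ B := by
  let x : Q.Label :=
    { str := s
      splits := {v | v ∈ B ∧ Q.IsSplit s v}
      isSplit := fun v hv => hv.2
      break_iff := fun v u hc =>
        ⟨fun hv hu => h v u hc hv.1 hu.1, fun hu =>
          ⟨(mem_or_mem_of_isConcat hB' hc hs).elim id fun hu' =>
            absurd ⟨hu', v, Or.inr hc⟩ hu, u, Or.inl hc⟩⟩ }
  exact ⟨x, rfl, J_subset hQ hB hB' hs fun v hv hsp => ⟨hv, hsp⟩⟩

theorem isLUB_toBic (hQ : Q.SelfAvoiding) (b : Q.Bic) :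
    IsLUB {c | ∃ x : Q.Label, x.toBic hQ = c ∧ x.toBic hQ ≤ b} b := by
  refine ⟨?_, fun c hc => ?_⟩
  · rintro c ⟨x, rfl, hx⟩
    exact hx
  · have key : ∀ (n : ℕ) (w : OString Q), w.len = n → w.toStr ∈ b.1 → w.toStr ∈ c.1 := by
      intro n
      induction n using Nat.strong_induction_on with
      | _ n ih =>
        rintro w rfl hw
        by_cases h : ∃ v u, Q.IsConcat w.toStr v u ∧ v ∈ b.1 ∧ u ∈ b.1
        · obtain ⟨v, u, hc', hv, hu⟩ := h
          have hc'' := hc'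
          obtain ⟨e, he, ⟨rfl, rfl⟩ | ⟨rfl, rfl⟩⟩ := hc'.exists_break
          all_goals
            have h1 := w.len_sub (i := 0) he.le
            have h2 := w.len_sub (i := e + 1) le_rfl
            exact c.2.1 _ (ih _ (by omega) _ rfl hv) _ (ih _ (by omega) _ rfl hu) _ hc''
        · push Not at h
          obtain ⟨x, hx, hxb⟩ := exists_label hQ b.2.1 b.2.2 hw h
          have : x.toBic hQ ≤ c := hc ⟨x, rfl, hxb⟩
          exact this (hx ▸ str_mem_J x)
    intro s hs
    obtain ⟨w, rfl⟩ := OString.exists_toStr s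
    exact key _ w rfl hs

theorem exists_toBic_eq [Finite Q.Bic] (hQ : Q.SelfAvoiding) {j : Q.Bic}
    (hj : IsJoinIrreducible j) : ∃ x : Q.Label, x.toBic hQ = j := by
  obtain ⟨x, hx, -⟩ := hj.mem_of_isLUB (fun T => ⟨_, isLUB_joinBic T⟩) (Set.toFinite _)
    (isLUB_toBic hQ j)
  exact ⟨x, hx⟩

/-! ### The faces of the canonical join complex -/

theorem coe_joinBic_image (hQ : Q.SelfAvoiding) (F : Set Q.Label) :
    (joinBic (toBic hQ '' F)).1 = join F := by
  change Q.strClosure _ = Q.strClosure _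
  congr 1
  ext s
  simp [toBic]

theorem Compatible.isCanonicalJoinRep (hQ : Q.SelfAvoiding) {F : Set Q.Label}
    (hF : Compatible F) : IsCanonicalJoinRep (toBic hQ '' F) (joinBic (toBic hQ '' F)) := by
  set b := joinBic (toBic hQ '' F) with hb
  have hbF : b.1 = join F := coe_joinBic_image hQ F
  -- A family with join `b` has a member that contains the string of a given label of `F`.
  have key : ∀ (T : Set Q.Bic), IsLUB T b → ∀ x ∈ F, ∃ c ∈ T, x.str ∈ c.1 := by
    intro T hT x hx
    by_contra! hcon
    have hle : b ≤ hF.joinDiff hQ hx := by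
      refine hT.2 fun c hc s hs => ⟨?_, ?_⟩
      · rw [← hbF]
        exact hT.1 hc hs
      · rintro rfl
        exact hcon c hc hs
    have hmem : x.str ∈ b.1 := by
      rw [hbF]
      exact J_subset_join hx (str_mem_J x)
    exact (hle hmem).2 rfl
  refine ⟨?_, ⟨isLUB_joinBic _, fun A hA hAb => ?_⟩, fun T _ hT => ?_⟩
  · rintro _ ⟨x, -, rfl⟩
    exact isJoinIrreducible_toBic hQ x
  · obtain ⟨_, ⟨x, hx, rfl⟩, hxA⟩ := Set.exists_of_ssubset hA
    obtain ⟨c, hc, hxc⟩ := key A hAb x hx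
    obtain ⟨y, hy, rfl⟩ := hA.1 hc
    obtain rfl := hF.eq_of_str_mem_J hQ hx hy hxc
    exact hxA hc
  · rintro _ ⟨x, hx, rfl⟩
    obtain ⟨c, hc, hxc⟩ := key T hT.1 x hx
    refine ⟨c, hc, J_subset hQ c.2.1 c.2.2 hxc fun v hv hs => ?_⟩
    refine hF.mem_splits_of_mem_join hQ hx ?_ hs
    rw [← hbF]
    exact hT.1.1 hc hv

/-- In a canonical join representation, replacing `J(w_D)` by the element that it covers gives a
smaller join, which therefore does not contain `w`. -/
theorem exists_join_of_mem_face [Finite Q.Bic] (hQ : Q.SelfAvoiding) {A : Set Q.Bic} {b : Q.Bic}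
    (hA : IsCanonicalJoinRep A b) {x : Q.Label} (hx : x.toBic hQ ∈ A) :
    ∃ c : Q.Bic, x.lower hQ ≤ c ∧ (∀ a ∈ A, a ≠ x.toBic hQ → a ≤ c) ∧ x.str ∉ c.1 := by
  obtain ⟨hJ, ⟨hlub, hirr⟩, href⟩ := hA
  have hc := isLUB_joinBic (insert (x.lower hQ) (A \ {x.toBic hQ}))
  set c := joinBic (insert (x.lower hQ) (A \ {x.toBic hQ}))
  refine ⟨c, hc.1 (Or.inl rfl), fun a ha hne => hc.1 (Or.inr ⟨ha, hne⟩), fun hxc => ?_⟩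
  -- If `w ∈ c`, then `c = b` is also the join of `T`, and `J(w_D)` lies below no element of `T`.
  have hxle : x.toBic hQ ≤ c := by
    intro s hs
    by_cases h : s = x.str
    · exact h ▸ hxc
    · refine hc.1 (Or.inl rfl) ?_
      change s ∈ (x.lower hQ).1
      rw [coe_lower]
      exact ⟨hs, h⟩
  set T : Set Q.Bic := {c | ∃ y : Q.Label, y.toBic hQ = c ∧ y.toBic hQ ≤ x.lower hQ} ∪
    (A \ {x.toBic hQ}) with hT
  have hlow : x.lower hQ ≤ x.toBic hQ := by
    change (x.lower hQ).1 ⊆ x.J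
    rw [coe_lower]
    exact Set.sdiff_subset
  have hTb : IsLUB T b := by
    refine ⟨?_, fun d hd => hlub.2 ?_⟩
    · rintro a (⟨y, rfl, hy⟩ | ha)
      · exact (hy.trans hlow).trans (hlub.1 hx)
      · exact hlub.1 ha.1
    · have hcd : c ≤ d := by
        refine hc.2 ?_
        rintro a (rfl | ha)
        · exact (isLUB_toBic hQ _).2 fun a ha => hd (Or.inl ha)
        · exact hd (Or.inr ha)
      intro a ha
      by_cases h : a = x.toBic hQ
      · exact h ▸ hxle.trans hcd
      · exact hd (Or.inr ⟨ha, h⟩)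
  have hTJ : ∀ a ∈ T, IsJoinIrreducible a := by
    rintro a (⟨y, rfl, -⟩ | ha)
    · exact isJoinIrreducible_toBic hQ y
    · exact hJ a ha.1
  obtain ⟨Y, hYT, hY⟩ := exists_isIrredundantJoin hTb
  obtain ⟨a, ha, hxa⟩ := href Y (fun a ha => hTJ a (hYT ha)) hY _ hx
  rcases hYT ha with ⟨y, rfl, hy⟩ | ha
  · exact not_toBic_le_lower hQ x (hxa.trans hy)
  · refine hirr (A \ {x.toBic hQ}) ⟨Set.sdiff_subset, fun h => (h hx).2 rfl⟩
      ⟨fun d hd => hlub.1 hd.1, fun d hd => hlub.2 fun e he => ?_⟩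
    by_cases h : e = x.toBic hQ
    · exact h ▸ hxa.trans (hd ha)
    · exact hd ⟨he, h⟩

end Label

theorem SelfAvoiding.finite_str [Finite V] [Finite E] (hQ : Q.SelfAvoiding) : Finite Q.Str := by
  have hlen : ∀ w : OString Q, w.letters.length < Nat.card V + 1 := by
    intro w
    have hinj : Function.Injective fun i : Fin (w.len + 1) => w.vert i := by
      intro i j h
      exact Fin.ext (hQ w i j (by omega) (by omega) h)
    have := Nat.card_le_card_of_injective _ hinj
    rw [Nat.card_fin] at this
    simp only [OString.len] at this
    omega
  have hfin : Finite {l : List (E × Bool) // l.length < Nat.card V + 1} :=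
    (List.finite_length_lt _ _).to_subtype
  have : Finite (OString Q) := by
    refine Finite.of_injective (fun w => ((w.start, ⟨w.letters, hlen w⟩) :
      V × {l : List (E × Bool) // l.length < Nat.card V + 1})) ?_
    intro w w' h
    simp only [Prod.mk.injEq, Subtype.mk.injEq] at h
    exact OString.ext h.1 h.2
  exact Quotient.finite _

open Label in
theorem SelfAvoiding.bijOn_J_and_face_iff [Finite V] [Finite E] (hQ : Q.SelfAvoiding) :
    Set.BijOn (fun x : Q.Label => x.J) Set.univ
        {B : Set Q.Str | ∃ b : Q.Bic, IsJoinIrreducible b ∧ (b : Set Q.Str) = B} ∧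
      ∀ F : Set Q.Label,
        (∃ 𝓕 ∈ canonicalJoinComplex Q.Bic,
            (fun b : Q.Bic => (b : Set Q.Str)) '' 𝓕 = (fun x : Q.Label => x.J) '' F) ↔
          ∀ x ∈ F, ∀ y ∈ F, x ≠ y →
            x.str ≠ y.str ∧
            (¬ Q.IsProperConcatOf (x.J ∪ y.J) x.str ∧ ¬ Q.IsProperConcatOf (x.J ∪ y.J) y.str) ∧
            (¬ x.J ⊆ y.J ∧ ¬ y.J ⊆ x.J) := by
  have := hQ.finite_str
  refine ⟨⟨fun x _ => ⟨x.toBic hQ, isJoinIrreducible_toBic hQ x, rfl⟩,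
    (J_injective hQ).injOn, ?_⟩, fun F => ⟨?_, fun h => ?_⟩⟩
  · rintro _ ⟨b, hb, rfl⟩
    obtain ⟨x, rfl⟩ := exists_toBic_eq hQ hb
    exact ⟨x, trivial, rfl⟩
  · rintro ⟨A, ⟨b, hA⟩, hAF⟩
    have hmem : ∀ x ∈ F, x.toBic hQ ∈ A := by
      intro x hx
      obtain ⟨a, ha, hax⟩ := hAF.ge ⟨x, hx, rfl⟩
      obtain rfl : a = x.toBic hQ := Subtype.ext hax
      exact ha
    have key : ∀ x ∈ F, ∀ y ∈ F, x ≠ y → x.str ∉ y.J ∧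
        ¬ Q.IsProperConcatOf (x.J ∪ y.J) x.str := by
      intro x hx y hy hxy
      obtain ⟨c, hlow, hle, hxc⟩ := exists_join_of_mem_face hQ hA (hmem x hx)
      have hyc : y.J ⊆ c.1 := hle _ (hmem y hy) fun h =>
        hxy (J_injective hQ (congrArg Subtype.val h)).symm
      refine ⟨fun h => hxc (hyc h), fun h => ?_⟩
      obtain ⟨g, hg | hg, h⟩ := exists_isProperConcatOf h
      · exact not_isProperConcatOf_J hQ x
          (h.mono (Set.insert_subset hg (splits_subset_J x)))
      · refine hxc ((h.mono (Set.insert_subset (hyc hg) fun v hv => hlow ?_)).mem c.2.1)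
        change v ∈ (x.lower hQ).1
        rw [coe_lower]
        refine ⟨splits_subset_J x hv, ?_⟩
        rintro rfl
        exact str_notMem_splits hQ hv
    intro x hx y hy hxy
    obtain ⟨h1, h2⟩ := key x hx y hy hxy
    obtain ⟨h3, h4⟩ := key y hy x hx hxy.symm
    rw [Set.union_comm] at h4
    exact ⟨fun h => h1 (h ▸ str_mem_J y), ⟨h2, h4⟩, fun h => h1 (h (str_mem_J x)),
      fun h => h3 (h (str_mem_J y))⟩
  · have hF : Compatible F := fun x hx y hy hxy =>
      ⟨(h x hx y hy hxy).2.1.1, (h x hx y hy hxy).2.2.1⟩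
    refine ⟨_, ⟨_, hF.isCanonicalJoinRep hQ⟩, ?_⟩
    rw [Set.image_image]
    rfl

/-! ### Endomorphisms of modules over a brick algebra -/

/-- A finite-dimensional representation whose only idempotent endomorphisms are `0` and `1` is
indecomposable, so over a brick algebra its nonzero endomorphisms are invertible. -/
theorem IsBrickAlgebra.isUnit_of_commute.{u} {k : Type u} [Field k] [Fintype V]
    (hQ : Q.IsBrickAlgebra k) {M : Type u} [AddCommGroup M] [Module k M] [Module.Finite k M]
    [Nontrivial M] (φ : Q.BoundPathAlgebra k →ₐ[k] Module.End k M)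
    (hidem : ∀ f : Module.End k M, (∀ a, Commute f (φ a)) → f * f = f → f = 0 ∨ f = 1)
    {f : Module.End k M} (hf : ∀ a, Commute f (φ a)) (hf0 : f ≠ 0) : IsUnit f := by
  let _ : Module (Q.BoundPathAlgebra k) M := Module.compHom M φ.toRingHom
  have smul_def : ∀ (a : Q.BoundPathAlgebra k) (m : M), a • m = φ a m := fun _ _ => rfl
  have : IsScalarTower k (Q.BoundPathAlgebra k) M := ⟨fun c a m => by
    rw [smul_def, smul_def, map_smul]; rfl⟩
  have : Module.Finite (Q.BoundPathAlgebra k) M := Module.Finite.of_restrictScalars_finite k _ M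
  have toEnd : ∀ g : Module.End k M, (∀ a, Commute g (φ a)) →
      ∃ G : Module.End (Q.BoundPathAlgebra k) M, ∀ m, G m = g m := fun g hg =>
    ⟨{ toFun := g, map_add' := g.map_add,
       map_smul' := fun a m => LinearMap.congr_fun (hg a).eq m }, fun _ => rfl⟩
  have ofEnd : ∀ (G : Module.End (Q.BoundPathAlgebra k) M),
      ∃ g : Module.End k M, (∀ a, Commute g (φ a)) ∧ ∀ m, g m = G m := fun G =>
    ⟨G.restrictScalars k, fun a => LinearMap.ext fun m => G.map_smul a m, fun _ => rfl⟩
  have hind : IsIndecomposableModule (Q.BoundPathAlgebra k) M := by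
    refine ⟨inferInstance, fun N P hNP => ?_⟩
    obtain ⟨g, hg, hgG⟩ := ofEnd (N.projection P hNP)
    have hgg : g * g = g := by
      ext m
      rw [Module.End.mul_apply, hgG, hgG]
      exact Submodule.projection_apply_of_mem_left hNP (Submodule.projection_apply_mem hNP m)
    rcases hidem g hg hgg with rfl | rfl
    · refine Or.inl ((Submodule.eq_bot_iff _).2 fun m hm => ?_)
      rw [← Submodule.projection_apply_of_mem_left hNP hm, ← hgG]
      rfl
    · refine Or.inr ((Submodule.eq_bot_iff _).2 fun m hm => ?_)
      rw [← (Submodule.projection_apply_eq_zero_iff hNP).2 hm, ← hgG]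
      rfl
  obtain ⟨F, hF⟩ := toEnd f hf
  have hF0 : F ≠ 0 := by
    rintro rfl
    exact hf0 (LinearMap.ext fun m => (hF m).symm)
  obtain ⟨U, hU⟩ := (hQ M inferInstance hind).2 F hF0
  obtain ⟨g, -, hg⟩ := ofEnd ↑U⁻¹
  have h1 : ∀ m, f (g m) = m := by
    intro m
    rw [hg, ← hF, ← hU, ← Module.End.mul_apply, Units.mul_inv, Module.End.one_apply]
  have h2 : ∀ m, g (f m) = m := by
    intro m
    rw [hg, ← hF, ← hU, ← Module.End.mul_apply, Units.inv_mul, Module.End.one_apply]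
  exact ⟨⟨f, g, LinearMap.ext h1, LinearMap.ext h2⟩, rfl⟩

/-! ### Representations with a basis on which the arrows act by partial maps -/

section BasisRep

variable {k : Type*} [Field k] {I : Type}

open Classical in
/-- The operator on `I → k` that sends the basis vector of `i` to the sum of those of the `j` with
`r i j`, for a relation `r` that relates at most one `i` to each `j`. -/
noncomputable def pull (k : Type*) [Field k] (r : I → I → Prop) : Module.End k (I → k) where
  toFun m j := if h : ∃ i, r i j then m h.choose else 0
  map_add' m n := by
    ext j
    by_cases h : ∃ i, r i j <;> simp [h]
  map_smul' c m := by
    ext j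
    by_cases h : ∃ i, r i j <;> simp [h]

theorem pull_apply_of {r : I → I → Prop} (hr : ∀ i i' j, r i j → r i' j → i = i') {i j : I}
    (h : r i j) (m : I → k) : pull k r m j = m i := by
  have h' : ∃ i, r i j := ⟨i, h⟩
  simp only [pull, LinearMap.coe_mk, AddHom.coe_mk, dif_pos h']
  rw [hr _ _ _ h'.choose_spec h]

theorem pull_apply_eq_zero {r : I → I → Prop} {j : I} (h : ∀ i, ¬ r i j) (m : I → k) :
    pull k r m j = 0 := by
  have h' : ¬ ∃ i, r i j := fun ⟨i, hi⟩ => h i hi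
  simp only [pull, LinearMap.coe_mk, AddHom.coe_mk, dif_neg h']

/-- The composite of two operators `pull r` and `pull s` belongs to the composite relation. -/
theorem pull_mul {r s t : I → I → Prop} (hr : ∀ i i' j, r i j → r i' j → i = i')
    (hs : ∀ i i' j, s i j → s i' j → i = i') (h : ∀ l j, t l j ↔ ∃ i, s l i ∧ r i j) :
    pull k r * pull k s = pull k t := by
  have ht : ∀ i i' j, t i j → t i' j → i = i' := by
    intro i i' j h1 h2
    obtain ⟨a, h1, h1'⟩ := (h _ _).1 h1
    obtain ⟨b, h2, h2'⟩ := (h _ _).1 h2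
    obtain rfl := hr _ _ _ h1' h2'
    exact hs _ _ _ h1 h2
  refine LinearMap.ext fun m => funext fun j => ?_
  rw [Module.End.mul_apply]
  by_cases hj : ∃ i, r i j
  · obtain ⟨i, hi⟩ := hj
    rw [pull_apply_of hr hi]
    by_cases hl : ∃ l, s l i
    · obtain ⟨l, hl⟩ := hl
      rw [pull_apply_of hs hl, pull_apply_of ht ((h l j).2 ⟨i, hl, hi⟩)]
    · push Not at hl
      rw [pull_apply_eq_zero hl, pull_apply_eq_zero]
      intro l hlj
      obtain ⟨i', h1, h2⟩ := (h _ _).1 hlj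
      obtain rfl := hr _ _ _ hi h2
      exact hl l h1
  · push Not at hj
    rw [pull_apply_eq_zero hj, pull_apply_eq_zero]
    intro l hlj
    obtain ⟨i', -, h2⟩ := (h _ _).1 hlj
    exact hj i' h2

theorem pull_single_of [DecidableEq I] {r : I → I → Prop}
    (hr : ∀ i i' j, r i j → r i' j → i = i') (hr' : ∀ i j j', r i j → r i j' → j = j') {i j : I}
    (h : r i j) : pull k r (Pi.single i 1) = Pi.single j 1 := by
  ext l
  by_cases hl : l = j
  · subst hl
    rw [pull_apply_of hr h, Pi.single_eq_same, Pi.single_eq_same]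
  · rw [Pi.single_eq_of_ne hl]
    by_cases hex : ∃ n, r n l
    · obtain ⟨n, hn⟩ := hex
      rw [pull_apply_of hr hn, Pi.single_eq_of_ne]
      rintro rfl
      exact hl (hr' _ _ _ hn h)
    · push Not at hex
      exact pull_apply_eq_zero hex _

/-- An idempotent that differs from a scalar only by entries with column in `S` and row outside
`S` is `0` or `1`. -/
theorem eq_zero_or_one_of_idem [Finite I] [DecidableEq I] {f : Module.End k (I → k)} (c : k)
    (S : Set I)
    (h : ∀ i l, f (Pi.single i 1) l = (Pi.single i c : I → k) l ∨ (i ∈ S ∧ l ∉ S))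
    (hf : f * f = f) : f = 0 ∨ f = 1 := by
  have := Fintype.ofFinite I
  set g := f - c • (1 : Module.End k (I → k)) with hg
  have hg0 : ∀ i l, g (Pi.single i 1) l = 0 ∨ (i ∈ S ∧ l ∉ S) := by
    intro i l
    refine (h i l).imp (fun h => ?_) id
    rw [hg, LinearMap.sub_apply, Pi.sub_apply, h, LinearMap.smul_apply, Module.End.one_apply,
      Pi.smul_apply, smul_eq_mul, Pi.single_apply, Pi.single_apply]
    split_ifs <;> simp
  have hgS : ∀ i, i ∉ S → g (Pi.single i 1) = 0 := fun i hi =>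
    funext fun l => (hg0 i l).resolve_right fun h => hi h.1
  have hgg : g * g = 0 := by
    refine LinearMap.pi_ext' fun i => LinearMap.ext_ring ?_
    simp only [LinearMap.comp_apply, LinearMap.single_apply, Module.End.mul_apply,
      LinearMap.zero_apply]
    have hsum : g (Pi.single i 1) = ∑ l, g (Pi.single i 1) l • (Pi.single l 1 : I → k) := by
      ext j
      simp [Finset.sum_apply, Pi.single_apply]
    rw [hsum, map_sum]
    refine Finset.sum_eq_zero fun l _ => ?_
    rw [map_smul]
    rcases hg0 i l with h | h
    · rw [h, zero_smul]
    · rw [hgS l h.2, smul_zero]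
  have hfg : f = g + c • 1 := by rw [hg]; abel
  by_cases hc : c = 0
  · rw [hc, zero_smul, add_zero] at hfg
    rw [← hfg, hf] at hgg
    exact Or.inl hgg
  · right
    -- Expanding `(f - c)² (f - 1) = 0` with `f² = f` leaves `c² (f - 1) = 0`.
    have h1 : c • c • (f - 1) = 0 := by
      have h2 : g * g * (f - 1) = c • c • (f - 1) := by
        have h3 : g * (f - 1) = (-c) • (f - 1) := by
          rw [hg, sub_mul, mul_sub, hf, mul_one, sub_self, zero_sub, smul_mul_assoc, one_mul]
          exact (neg_smul c (f - 1)).symm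
        rw [mul_assoc, h3, mul_smul_comm, h3, smul_smul, smul_smul, neg_mul_neg]
      rw [← h2, hgg, zero_mul]
    rw [smul_eq_zero_iff_right hc, smul_eq_zero_iff_right hc, sub_eq_zero] at h1
    exact h1

open Classical in
/-- The idempotent of the vertex `v` on a representation whose basis vectors lie over the vertices
given by `p`. -/
noncomputable def vertexProj (k : Type*) [Field k] (p : I → V) (v : V) : Module.End k (I → k) where
  toFun m j := if p j = v then m j else 0
  map_add' m n := by
    ext j
    by_cases h : p j = v <;> simp [h]
  map_smul' c m := by
    ext j
    by_cases h : p j = v <;> simp [h]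

theorem vertexProj_apply_of {p : I → V} {v : V} {j : I} (h : p j = v) (m : I → k) :
    vertexProj k p v m j = m j := if_pos h

theorem vertexProj_apply_eq_zero {p : I → V} {v : V} {j : I} (h : p j ≠ v) (m : I → k) :
    vertexProj k p v m j = 0 := if_neg h

/-- A finite set `I` of basis vectors, lying over the vertices given by `p`, on which every arrow
acts by an injective partial map: `st α i j` says that `α` sends `i` to `j`. -/
structure BasisRep (Q : BoundQuiver V E) (I : Type) where
  /-- the vertex of a basis vector -/
  p : I → V
  /-- the action of the arrows -/
  st : E → I → I → Prop
  left_unique : ∀ α i i' j, st α i j → st α i' j → i = i'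
  right_unique : ∀ α i j j', st α i j → st α i j' → j = j'
  src_eq : ∀ α i j, st α i j → p i = Q.src α
  tgt_eq : ∀ α i j, st α i j → p j = Q.tgt α
  rel_eq : ∀ β α i j l, Q.rel β α → st α i j → ¬ st β j l

namespace BasisRep

variable (R : BasisRep Q I)

/-- The action of the generators of `kQ/I`. -/
noncomputable def gen (k : Type*) [Field k] : V ⊕ E → Module.End k (I → k) :=
  Sum.elim (vertexProj k R.p) fun α => pull k (R.st α)

/-- The representation of `kQ/I` given by a `BasisRep`. -/
noncomputable def toAlgHom [Fintype V] (k : Type*) [Field k] : Q.BoundPathAlgebra k →ₐ[k] Module.End k (I → k) := by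
  refine RingQuot.liftAlgHom k ⟨FreeAlgebra.lift k (R.gen k), ?_⟩
  intro x y h
  induction h with
  | idem v =>
    simp only [map_mul, FreeAlgebra.lift_ι_apply, gen, Sum.elim_inl]
    refine LinearMap.ext fun m => funext fun j => ?_
    rw [Module.End.mul_apply]
    by_cases h : R.p j = v
    · rw [vertexProj_apply_of h]
    · rw [vertexProj_apply_eq_zero h, vertexProj_apply_eq_zero h]
  | orth u v huv =>
    simp only [map_mul, FreeAlgebra.lift_ι_apply, gen, Sum.elim_inl, map_zero]
    refine LinearMap.ext fun m => funext fun j => ?_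
    rw [Module.End.mul_apply]
    by_cases h : R.p j = u
    · rw [vertexProj_apply_of h, vertexProj_apply_eq_zero (h ▸ huv)]; rfl
    · rw [vertexProj_apply_eq_zero h]; rfl
  | one =>
    simp only [map_sum, FreeAlgebra.lift_ι_apply, gen, Sum.elim_inl, map_one]
    refine LinearMap.ext fun m => funext fun j => ?_
    rw [LinearMap.sum_apply, Finset.sum_apply, Finset.sum_eq_single (R.p j)]
    · rw [vertexProj_apply_of rfl]; rfl
    · intro v _ hv
      exact vertexProj_apply_eq_zero hv.symm _
    · simp
  | left α =>
    simp only [map_mul, FreeAlgebra.lift_ι_apply, gen, Sum.elim_inl, Sum.elim_inr]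
    refine LinearMap.ext fun m => funext fun j => ?_
    rw [Module.End.mul_apply]
    by_cases h : R.p j = Q.tgt α
    · rw [vertexProj_apply_of h]
    · rw [vertexProj_apply_eq_zero h, pull_apply_eq_zero]
      exact fun i hi => h (R.tgt_eq α i j hi)
  | right α =>
    simp only [map_mul, FreeAlgebra.lift_ι_apply, gen, Sum.elim_inl, Sum.elim_inr]
    refine LinearMap.ext fun m => funext fun j => ?_
    rw [Module.End.mul_apply]
    by_cases h : ∃ i, R.st α i j
    · obtain ⟨i, hi⟩ := h
      rw [pull_apply_of (R.left_unique α) hi, pull_apply_of (R.left_unique α) hi,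
        vertexProj_apply_of (R.src_eq α i j hi)]
    · push Not at h
      rw [pull_apply_eq_zero h, pull_apply_eq_zero h]
  | rel β α h =>
    simp only [map_mul, FreeAlgebra.lift_ι_apply, gen, Sum.elim_inr, map_zero]
    have h0 : pull k (fun _ _ : I => False) = 0 :=
      LinearMap.ext fun m => funext fun j => pull_apply_eq_zero (fun _ => id) m
    rw [← h0]
    refine pull_mul (R.left_unique β) (R.left_unique α) fun l j => ⟨False.elim, ?_⟩
    rintro ⟨i, h1, h2⟩
    exact R.rel_eq β α _ _ _ h h1 h2

theorem commute_toAlgHom [Fintype V] {k : Type*} [Field k] {f : Module.End k (I → k)}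
    (hf : ∀ g, Commute f (R.gen k g)) (a : Q.BoundPathAlgebra k) :
    Commute f (R.toAlgHom k a) := by
  obtain ⟨a, rfl⟩ := RingQuot.mkAlgHom_surjective k (AlgebraRel k Q) a
  rw [toAlgHom, RingQuot.liftAlgHom_mkAlgHom_apply]
  induction a using FreeAlgebra.induction with
  | grade0 r => rw [AlgHom.commutes]; exact Algebra.commute_algebraMap_right r f
  | grade1 g => rw [FreeAlgebra.lift_ι_apply]; exact hf g
  | mul a b ha hb => rw [map_mul]; exact ha.mul_right hb
  | add a b ha hb => rw [map_add]; exact ha.add_right hb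

theorem commute_gen [Fintype V] {k : Type*} [Field k] {f : Module.End k (I → k)}
    (hf : ∀ a, Commute f (R.toAlgHom k a)) (g : V ⊕ E) : Commute f (R.gen k g) := by
  have := hf (RingQuot.mkAlgHom k (AlgebraRel k Q) (FreeAlgebra.ι k g))
  rwa [toAlgHom, RingQuot.liftAlgHom_mkAlgHom_apply, FreeAlgebra.lift_ι_apply] at this

variable [DecidableEq I] {R} {k : Type*} [Field k] {f : Module.End k (I → k)}

/-- Endomorphisms preserve vertices. -/
theorem apply_single_eq_zero (hf : ∀ g, Commute f (R.gen k g)) {i l : I} (h : R.p l ≠ R.p i) :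
    f (Pi.single i 1) l = 0 := by
  have h1 : vertexProj k R.p (R.p i) (Pi.single i 1) = Pi.single i 1 := by
    ext j
    by_cases hj : R.p j = R.p i
    · rw [vertexProj_apply_of hj]
    · rw [vertexProj_apply_eq_zero hj, Pi.single_eq_of_ne]
      rintro rfl
      exact hj rfl
  have h2 := congrFun (LinearMap.congr_fun (hf (Sum.inl (R.p i))).eq (Pi.single i 1)) l
  simp only [Module.End.mul_apply, gen, Sum.elim_inl, h1] at h2
  rw [h2, vertexProj_apply_eq_zero h]

theorem apply_single_eq (hf : ∀ g, Commute f (R.gen k g)) {α : E} {i j l m : I}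
    (h : R.st α i j) (h' : R.st α l m) : f (Pi.single j 1) m = f (Pi.single i 1) l := by
  have h2 := congrFun (LinearMap.congr_fun (hf (Sum.inr α)).eq (Pi.single i 1)) m
  simp only [Module.End.mul_apply, gen, Sum.elim_inr] at h2
  rwa [pull_single_of (R.left_unique α) (R.right_unique α) h,
    pull_apply_of (R.left_unique α) h'] at h2

theorem apply_single_eq_zero_of_not (hf : ∀ g, Commute f (R.gen k g)) {α : E} {i j m : I}
    (h : R.st α i j) (h' : ∀ l, ¬ R.st α l m) : f (Pi.single j 1) m = 0 := by
  have h2 := congrFun (LinearMap.congr_fun (hf (Sum.inr α)).eq (Pi.single i 1)) m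
  simp only [Module.End.mul_apply, gen, Sum.elim_inr] at h2
  rwa [pull_single_of (R.left_unique α) (R.right_unique α) h, pull_apply_eq_zero h'] at h2

/-- Over a brick algebra there is no `BasisRep` with a local endomorphism ring and a nilpotent
endomorphism `pull r`. -/
theorem not_isBrickAlgebra.{u} {k : Type u} [Field k] [Fintype V] [Finite I] (R : BasisRep Q I) (S : Set I)
    (hloc : ∀ f : Module.End k (I → k), (∀ g, Commute f (R.gen k g)) → ∃ c : k,
      ∀ i l, f (Pi.single i 1) l = (Pi.single i c : I → k) l ∨ (i ∈ S ∧ l ∉ S))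
    (r : I → I → Prop) (hr : ∀ i i' j, r i j → r i' j → i = i')
    (hrp : ∀ i j, r i j → R.p i = R.p j) (hne : ∃ i j, r i j)
    (hnil : ∀ i j l, r i j → ¬ r j l)
    (hcomm : ∀ α i j, (∃ l, R.st α i l ∧ r l j) ↔ ∃ l, r i l ∧ R.st α l j) :
    ¬ Q.IsBrickAlgebra k := by
  intro hQ
  obtain ⟨i₀, j₀, h₀⟩ := hne
  have : Nonempty I := ⟨i₀⟩
  have hgen : ∀ g, Commute (pull k r) (R.gen k g) := by
    rintro (v | α)
    · refine LinearMap.ext fun m => funext fun j => ?_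
      simp only [Module.End.mul_apply, gen, Sum.elim_inl]
      by_cases h : ∃ i, r i j
      · obtain ⟨i, hi⟩ := h
        rw [pull_apply_of hr hi]
        by_cases hv : R.p j = v
        · rw [vertexProj_apply_of hv, vertexProj_apply_of ((hrp i j hi).trans hv),
            pull_apply_of hr hi]
        · rw [vertexProj_apply_eq_zero hv, vertexProj_apply_eq_zero (by rwa [hrp i j hi])]
      · push Not at h
        rw [pull_apply_eq_zero h]
        by_cases hv : R.p j = v
        · rw [vertexProj_apply_of hv, pull_apply_eq_zero h]
        · rw [vertexProj_apply_eq_zero hv]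
    · have h1 := pull_mul (k := k) hr (R.left_unique α) (fun l j => Iff.rfl)
      have h2 := pull_mul (k := k) (R.left_unique α) hr (hcomm α)
      exact h1.trans h2.symm
  have hnil' : pull k r * pull k r = 0 := by
    have h0 : pull k (fun _ _ : I => False) = 0 :=
      LinearMap.ext fun m => funext fun j => pull_apply_eq_zero (fun _ => id) m
    rw [← h0]
    refine pull_mul hr hr fun l j => ⟨False.elim, ?_⟩
    rintro ⟨i, h1, h2⟩
    exact hnil _ _ _ h1 h2
  have hne0 : pull k r ≠ 0 := by
    intro h
    have := congrFun (LinearMap.congr_fun h (Pi.single i₀ 1)) j₀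
    rw [pull_apply_of hr h₀, Pi.single_eq_same] at this
    exact one_ne_zero this
  have hunit : IsUnit (pull k r) := by
    refine hQ.isUnit_of_commute (R.toAlgHom k) (fun f hf hff => ?_)
      (R.commute_toAlgHom hgen) hne0
    obtain ⟨c, hc⟩ := hloc f (R.commute_gen hf)
    exact eq_zero_or_one_of_idem c S hc hff
  exact hne0 (hunit.mul_left_eq_zero.1 hnil')

end BasisRep

end BasisRep

/-! ### String modules -/

namespace OString

theorem lt_len_of_getElem? {w : OString Q} {n : ℕ} {l : E × Bool} (h : w.letters[n]? = some l) :
    n < w.len :=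
  (List.getElem?_eq_some_iff.1 h).1

theorem vert_of_getElem? {w : OString Q} {n : ℕ} {l : E × Bool} (h : w.letters[n]? = some l) :
    w.vert n = Q.lsrc l := by
  obtain ⟨hn, rfl⟩ := List.getElem?_eq_some_iff.1 h
  exact (w.lsrc_getElem hn).symm

theorem vert_succ_of_getElem? {w : OString Q} {n : ℕ} {l : E × Bool}
    (h : w.letters[n]? = some l) : w.vert (n + 1) = Q.ltgt l := by
  obtain ⟨hn, rfl⟩ := List.getElem?_eq_some_iff.1 h
  exact w.vert_succ hn

theorem follows_of_getElem? {w : OString Q} {n : ℕ} {l m : E × Bool}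
    (h : w.letters[n]? = some l) (h' : w.letters[n + 1]? = some m) : Q.Follows l m := by
  obtain ⟨_, rfl⟩ := List.getElem?_eq_some_iff.1 h
  obtain ⟨h2, rfl⟩ := List.getElem?_eq_some_iff.1 h'
  exact List.isChain_iff_getElem.1 w.chain n h2

/-- The arrow `α` occurs in `w` between the positions `i` and `j`, and points from `i` to `j`. -/
def Step (w : OString Q) (α : E) (i j : ℕ) : Prop :=
  (w.letters[i]? = some (α, true) ∧ j = i + 1) ∨ (w.letters[j]? = some (α, false) ∧ i = j + 1)

variable {w : OString Q} {α β : E} {i i' j j' l : ℕ}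

theorem Step.left_unique (h : w.Step α i j) (h' : w.Step α i' j) : i = i' := by
  rcases h with ⟨h, rfl⟩ | ⟨h, rfl⟩ <;> rcases h' with ⟨h', h1⟩ | ⟨h', rfl⟩
  · omega
  · exact absurd rfl (follows_of_getElem? h h').2.1
  · subst h1
    exact absurd rfl (follows_of_getElem? h' h).2.1
  · rfl

theorem Step.right_unique (h : w.Step α i j) (h' : w.Step α i j') : j = j' := by
  rcases h with ⟨h, rfl⟩ | ⟨h, rfl⟩ <;> rcases h' with ⟨h', h1⟩ | ⟨h', h1⟩
  · exact h1.symm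
  · subst h1
    exact absurd rfl (follows_of_getElem? h' h).2.1
  · exact absurd rfl (follows_of_getElem? h h').2.1
  · omega

theorem Step.src_eq (h : w.Step α i j) : w.vert i = Q.src α := by
  rcases h with ⟨h, rfl⟩ | ⟨h, rfl⟩
  · exact vert_of_getElem? h
  · exact vert_succ_of_getElem? h

theorem Step.tgt_eq (h : w.Step α i j) : w.vert j = Q.tgt α := by
  rcases h with ⟨h, rfl⟩ | ⟨h, rfl⟩
  · exact vert_succ_of_getElem? h
  · exact vert_of_getElem? h

theorem Step.not_rel (h : w.Step α i j) (h' : w.Step β j l) : ¬ Q.rel β α := by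
  rcases h with ⟨h, rfl⟩ | ⟨h, rfl⟩ <;> rcases h' with ⟨h', h1⟩ | ⟨h', h1⟩
  · exact fun hr => (follows_of_getElem? h h').2.2.1 ⟨rfl, rfl, hr⟩
  · obtain rfl : i = l := by omega
    rw [h] at h'
    simp at h'
  · rw [h] at h'
    simp at h'
  · subst h1
    exact fun hr => (follows_of_getElem? h' h).2.2.2 ⟨rfl, rfl, hr⟩

/-- Every letter of a string is a step in one of the two directions. -/
theorem exists_step (w : OString Q) {n : ℕ} (h : n < w.len) :
    ∃ α, w.Step α n (n + 1) ∨ w.Step α (n + 1) n := by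
  have h1 : w.letters[n]? = some w.letters[n] := List.getElem?_eq_getElem h
  rcases hl : w.letters[n] with ⟨α, _ | _⟩
  · exact ⟨α, Or.inr (Or.inr ⟨by rw [h1, hl], rfl⟩)⟩
  · exact ⟨α, Or.inl (Or.inl ⟨by rw [h1, hl], rfl⟩)⟩

/-- The string module of `w`. -/
def basisRep (w : OString Q) : BasisRep Q (Fin (w.len + 1)) where
  p i := w.vert i
  st α i j := w.Step α i j
  left_unique _ _ _ _ h h' := Fin.ext (h.left_unique h')
  right_unique _ _ _ _ h h' := Fin.ext (h.right_unique h')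
  src_eq _ _ _ h := h.src_eq
  tgt_eq _ _ _ h := h.tgt_eq
  rel_eq _ _ _ _ _ hr h h' := h.not_rel h' hr

/-- The diagonal entries of an endomorphism of a string module agree. -/
theorem apply_single_self {k : Type*} [Field k] {f : Module.End k (Fin (w.len + 1) → k)}
    (hf : ∀ g, Commute f (w.basisRep.gen k g)) (i : Fin (w.len + 1)) :
    f (Pi.single i 1) i = f (Pi.single 0 1) 0 := by
  obtain ⟨n, hn⟩ := i
  induction n with
  | zero => rfl
  | succ n ih =>
    rw [← ih (by omega)]
    obtain ⟨α, h | h⟩ := w.exists_step (show n < w.len by omega)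
    · exact BasisRep.apply_single_eq (R := w.basisRep) hf (i := ⟨n, by omega⟩) h h
    · exact (BasisRep.apply_single_eq (R := w.basisRep) hf (α := α) (i := ⟨n + 1, hn⟩) (j := ⟨n, by omega⟩)
        (l := ⟨n + 1, hn⟩) (m := ⟨n, by omega⟩) h h).symm

/-- The string module of a closed string without other repeated vertices, whose first and last
letters are direct, has a nilpotent endomorphism that sends the basis vector of the start, which
lies in the top, to the one of the end, which lies in the socle. -/
theorem not_isBrickAlgebra_of_closed.{u} {k : Type u} [Field k] [Fintype V] (hlen : 0 < w.len)
    (hclosed : w.vert 0 = w.vert w.len)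
    (hinj : ∀ i j, i < j → j ≤ w.len → w.vert i = w.vert j → i = 0 ∧ j = w.len)
    (hfirst : w.letters[0]? = some (α, true)) (hlast : w.letters[w.len - 1]? = some (β, true)) :
    ¬ Q.IsBrickAlgebra k := by
  have hto0 : ∀ γ i, ¬ w.Step γ i 0 := by
    rintro γ i (⟨-, h⟩ | ⟨h, -⟩)
    · omega
    · rw [hfirst] at h
      simp at h
  have hfrom : ∀ γ j, ¬ w.Step γ w.len j := by
    rintro γ j (⟨h, -⟩ | ⟨h, h1⟩)
    · exact (lt_len_of_getElem? h).ne rfl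
    · obtain rfl : w.len - 1 = j := by omega
      rw [hlast] at h
      simp at h
  have hstep : w.Step β (w.len - 1) w.len := Or.inl ⟨hlast, by omega⟩
  refine w.basisRep.not_isBrickAlgebra {i | i.1 = 0} (fun f hf => ⟨f (Pi.single 0 1) 0, ?_⟩)
    (fun i j => i.1 = 0 ∧ j.1 = w.len) ?_ ?_ ?_ ?_ ?_
  · intro i l
    by_cases hil : l = i
    · subst hil
      left
      rw [apply_single_self hf, Pi.single_eq_same]
    · rw [Pi.single_eq_of_ne hil]
      by_cases hv : w.vert l = w.vert i
      · have hne : l.1 ≠ i.1 := fun h => hil (Fin.ext h)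
        rcases hne.lt_or_gt with hlt | hlt
        · left
          obtain ⟨h0, hd⟩ := hinj _ _ hlt (by omega) hv
          refine BasisRep.apply_single_eq_zero_of_not (R := w.basisRep) hf
            (i := ⟨w.len - 1, by omega⟩) (α := β) ?_ fun j => ?_
          · change w.Step β (w.len - 1) i
            rwa [hd]
          · change ¬ w.Step β j l
            rw [h0]
            exact hto0 β j
        · right
          obtain ⟨h0, hd⟩ := hinj _ _ hlt (by omega) hv.symm
          exact ⟨h0, fun h => hne (Eq.trans h h0.symm)⟩
      · exact Or.inl (BasisRep.apply_single_eq_zero (R := w.basisRep) hf hv)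
  · rintro i i' j ⟨h, -⟩ ⟨h', -⟩
    exact Fin.ext (h.trans h'.symm)
  · rintro i j ⟨h, h'⟩
    change w.vert i = w.vert j
    rw [h, h', hclosed]
  · exact ⟨⟨0, by omega⟩, ⟨w.len, by omega⟩, rfl, rfl⟩
  · rintro i j l ⟨-, h⟩ ⟨h', -⟩
    omega
  · intro γ i j
    constructor
    · rintro ⟨l, h1, h2, -⟩
      change w.Step γ i l at h1
      rw [h2] at h1
      exact absurd h1 (hto0 γ i)
    · rintro ⟨l, ⟨-, h2⟩, h1⟩
      change w.Step γ l j at h1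
      rw [h2] at h1
      exact absurd h1 (hfrom γ j)

/-- The string module of a string of the form `u x u`, with a direct letter `x`, has a nilpotent
endomorphism that sends the first copy of `u` to the second one. Here `d` is the length of `x u`. -/
theorem not_isBrickAlgebra_of_periodic.{u} {k : Type u} [Field k] [Fintype V] {d : ℕ}
    (hd : w.len + 1 = d + d)
    (hper : ∀ n, n + d < w.len → w.letters[n + d]? = w.letters[n]?)
    (hmid : w.letters[d - 1]? = some (α, true))
    (hvert : ∀ n, n + d ≤ w.len → w.vert (n + d) = w.vert n)
    (hinj : ∀ i j, i ≤ w.len → j ≤ w.len → w.vert i = w.vert j →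
      i = j ∨ i + d = j ∨ j + d = i) :
    ¬ Q.IsBrickAlgebra k := by
  have hd0 : 0 < d := by omega
  have hto0 : ∀ i, ¬ w.Step α i 0 := by
    rintro i (⟨-, h⟩ | ⟨h, -⟩)
    · omega
    · rcases Nat.lt_or_ge d w.len with h1 | h1
      · have h2 := hper 0 (by omega)
        rw [h, zero_add] at h2
        obtain ⟨e, rfl⟩ : ∃ e, d = e + 1 := ⟨d - 1, by omega⟩
        exact (follows_of_getElem? hmid h2).2.1 rfl
      · obtain rfl : d = 1 := by omega
        rw [hmid] at h
        simp at h
  have hmid' : ∀ γ, ¬ w.Step γ d (d - 1) := by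
    rintro γ (⟨-, h⟩ | ⟨h, -⟩)
    · omega
    · rw [hmid] at h
      simp at h
  have hstep : w.Step α (d - 1) d := Or.inl ⟨hmid, by omega⟩
  have hshift : ∀ γ i j, i < d → j < d → (w.Step γ (i + d) (j + d) ↔ w.Step γ i j) := by
    intro γ i j hi hj
    constructor
    · rintro (⟨h, h1⟩ | ⟨h, h1⟩)
      · exact Or.inl ⟨by rw [← hper i (lt_len_of_getElem? h), h], by omega⟩
      · exact Or.inr ⟨by rw [← hper j (lt_len_of_getElem? h), h], by omega⟩
    · rintro (⟨h, h1⟩ | ⟨h, h1⟩)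
      · exact Or.inl ⟨by rw [hper i (by omega), h], by omega⟩
      · exact Or.inr ⟨by rw [hper j (by omega), h], by omega⟩
  have hcross : ∀ γ i j, i < d → w.Step γ i (j + d) → i = d - 1 ∧ j = 0 := by
    rintro γ i j hi (⟨-, h⟩ | ⟨-, h⟩) <;> omega
  have hcross' : ∀ γ i j, j < d → ¬ w.Step γ (i + d) j := by
    intro γ i j hj h
    have h1 : i + d = d ∧ j = d - 1 := by
      rcases h with ⟨-, h⟩ | ⟨-, h⟩ <;> omega
    rw [h1.1, h1.2] at h
    exact hmid' γ h
  refine w.basisRep.not_isBrickAlgebra {i | i.1 < d} (fun f hf => ⟨f (Pi.single 0 1) 0, ?_⟩)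
    (fun i j => j.1 = i.1 + d) ?_ ?_ ?_ ?_ ?_
  · -- The entries that map the second copy of `u` to the first one agree, and the one next to the
    -- letter `x` vanishes.
    have hzero : ∀ n (hn : n < d), f (Pi.single ⟨n + d, by omega⟩ 1) ⟨n, by omega⟩ = 0 := by
      intro n
      induction n with
      | zero =>
        intro hn
        refine BasisRep.apply_single_eq_zero_of_not (R := w.basisRep) hf
            (i := ⟨d - 1, by omega⟩) (α := α) ?_ fun j => hto0 j
        change w.Step α (d - 1) (0 + d)
        rwa [zero_add]
      | succ n ih =>
        intro hn
        rw [← ih (by omega)]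
        obtain ⟨γ, h | h⟩ := w.exists_step (show n < w.len by omega)
        · exact BasisRep.apply_single_eq (R := w.basisRep) hf (α := γ)
            (i := ⟨n + d, by omega⟩) (l := ⟨n, by omega⟩)
            ((hshift γ n (n + 1) (by omega) hn).2 h) h
        · exact (BasisRep.apply_single_eq (R := w.basisRep) hf (α := γ)
            (i := ⟨n + 1 + d, by omega⟩) (j := ⟨n + d, by omega⟩) (l := ⟨n + 1, by omega⟩)
            (m := ⟨n, by omega⟩)
            ((hshift γ (n + 1) n hn (by omega)).2 h) h).symm
    intro i l
    by_cases hil : l = i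
    · subst hil
      left
      rw [apply_single_self hf, Pi.single_eq_same]
    · rw [Pi.single_eq_of_ne hil]
      by_cases hv : w.vert l = w.vert i
      · have hne : l.1 ≠ i.1 := fun h => hil (Fin.ext h)
        rcases hinj _ _ (by omega) (by omega) hv with h | h | h
        · exact absurd h hne
        · left
          have := hzero l.1 (by omega)
          have hi : i = ⟨l.1 + d, by omega⟩ := Fin.ext h.symm
          rw [hi]
          exact this
        · refine Or.inr ⟨?_, ?_⟩
          · change i.1 < d
            omega
          · change ¬ l.1 < d
            omega
      · exact Or.inl (BasisRep.apply_single_eq_zero (R := w.basisRep) hf hv)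
  · intro i i' j h h'
    exact Fin.ext (by omega)
  · intro i j h
    change w.vert i = w.vert j
    rw [h, hvert _ (by omega)]
  · exact ⟨⟨0, by omega⟩, ⟨d, by omega⟩, by simp⟩
  · intro i j l h h'
    omega
  · intro γ i j
    constructor
    · rintro ⟨l, h1, h2⟩
      change w.Step γ i l at h1
      have hl : l.1 < d := by omega
      have hi : i.1 < d := by
        by_contra hcon
        refine hcross' γ (i.1 - d) l hl ?_
        rwa [Nat.sub_add_cancel (by omega)]
      refine ⟨⟨i.1 + d, by omega⟩, rfl, ?_⟩
      change w.Step γ (i.1 + d) j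
      rw [h2]
      exact (hshift γ i l hi hl).2 h1
    · rintro ⟨l, h1, h2⟩
      change w.Step γ l j at h2
      rw [h1] at h2
      have hj : d ≤ j.1 := by
        by_contra hcon
        exact hcross' γ i j (by omega) h2
      refine ⟨⟨j.1 - d, by omega⟩, ?_, ?_⟩
      · change w.Step γ i (j.1 - d)
        refine (hshift γ i (j.1 - d) (by omega) (by omega)).1 ?_
        rwa [Nat.sub_add_cancel hj]
      · change j.1 = j.1 - d + d
        omega

end OString

/-! ### Strings over a brick algebra are self-avoiding -/

namespace OString

theorem getElem?_inv (w : OString Q) {n : ℕ} (h : n < w.len) :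
    w.inv.letters[n]? = w.letters[w.len - 1 - n]?.map linv := by
  simp only [inv]
  rw [List.getElem?_reverse (by simpa [len] using h), List.getElem?_map, List.length_map]
  rfl

theorem getElem?_sub (w : OString Q) {i j n : ℕ} (h : i + n < j) :
    (w.sub i j).letters[n]? = w.letters[i + n]? := by
  simp only [sub]
  rw [List.getElem?_drop, List.getElem?_take, if_pos h]

/-- The closed string `w` followed by itself. -/
def double (w : OString Q) (h : ∀ l ∈ w.letters.getLast?, ∀ m ∈ w.letters.head?, Q.Follows l m) :
    OString Q where
  start := w.start
  letters := w.letters ++ w.letters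
  start_eq := by
    intro l hl
    refine w.start_eq l ?_
    rw [List.head?_append] at hl
    simpa using hl
  chain := List.isChain_append.2 ⟨w.chain, w.chain, h⟩

theorem vert_double (w : OString Q)
    (h : ∀ l ∈ w.letters.getLast?, ∀ m ∈ w.letters.head?, Q.Follows l m) {m : ℕ}
    (hm : m ≤ w.len) (h0 : 0 < w.len) :
    (w.double h).vert (m + w.len) = (w.double h).vert m := by
  have hget : ∀ n < w.len, (w.double h).letters[n + w.len]? = (w.double h).letters[n]? := by
    intro n hn
    change (w.letters ++ w.letters)[n + w.letters.length]? = (w.letters ++ w.letters)[n]?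
    rw [List.getElem?_append_right (by omega), List.getElem?_append_left hn,
      Nat.add_sub_cancel]
  have hsome : ∀ n < w.len, ∃ l, (w.double h).letters[n]? = some l := by
    intro n hn
    refine ⟨w.letters[n]'hn, ?_⟩
    change (w.letters ++ w.letters)[n]? = _
    rw [List.getElem?_append_left hn, List.getElem?_eq_getElem hn]
  rcases m with _ | m
  · obtain ⟨l, hl⟩ := hsome 0 h0
    rw [vert_of_getElem? hl, vert_of_getElem? ((hget 0 h0).trans hl)]
  · obtain ⟨l, hl⟩ := hsome m hm
    rw [vert_succ_of_getElem? hl, Nat.add_right_comm,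
      vert_succ_of_getElem? ((hget m hm).trans hl)]

end OString

/-- A brick algebra has self-avoiding strings. A shortest closed string `w` whose end letters point
in the same direction gives a nilpotent endomorphism of the string module of `w`. Otherwise
the concatenation of `w` with itself is a string, and one gets such an endomorphism by removing its
first or its last letter. -/
theorem IsBrickAlgebra.selfAvoiding.{u} {k : Type u} [Field k] [Fintype V]
    (hQ : Q.IsBrickAlgebra k) : Q.SelfAvoiding := by
  classical
  by_contra hcon
  have hex : ∃ d, 0 < d ∧ ∃ (w : OString Q) (i : ℕ), i + d ≤ w.len ∧
      w.vert i = w.vert (i + d) := by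
    simp only [SelfAvoiding] at hcon
    push Not at hcon
    obtain ⟨w, i, j, hi, hj, h, hne⟩ := hcon
    rcases hne.lt_or_gt with hlt | hlt
    · exact ⟨j - i, by omega, w, i, by omega, by rwa [Nat.add_sub_cancel' hlt.le]⟩
    · exact ⟨i - j, by omega, w, j, by omega, by rw [Nat.add_sub_cancel' hlt.le, h]⟩
  obtain ⟨hd0, w₀, i₀, hi₀, hw₀⟩ := Nat.find_spec hex
  have hmin : ∀ (w : OString Q) (i j : ℕ), i < j → j ≤ w.len → w.vert i = w.vert j →
      Nat.find hex ≤ j - i := fun w i j hij hj h =>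
    Nat.find_min' hex ⟨by omega, w, i, by omega, by rwa [Nat.add_sub_cancel' hij.le]⟩
  set d := Nat.find hex
  obtain ⟨w, hlen, hclosed⟩ : ∃ w : OString Q, w.len = d ∧ w.vert 0 = w.vert d := by
    refine ⟨w₀.sub i₀ (i₀ + d), by rw [OString.len_sub _ hi₀]; omega, ?_⟩
    rw [OString.vert_sub _ (by omega) hi₀, OString.vert_sub _ (by omega) hi₀]
    exact hw₀
  clear hw₀ hi₀ w₀ i₀
  have hinj : ∀ w' : OString Q, w'.len = d → ∀ i j, i < j → j ≤ w'.len → w'.vert i = w'.vert j →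
      i = 0 ∧ j = w'.len := by
    intro w' hw' i j hij hj h
    have := hmin w' i j hij hj h
    omega
  obtain ⟨⟨α, a⟩, hα⟩ : ∃ l, w.letters[0]? = some l :=
    ⟨_, List.getElem?_eq_getElem (show 0 < w.len by omega)⟩
  obtain ⟨⟨β, b⟩, hβ⟩ : ∃ l, w.letters[d - 1]? = some l :=
    ⟨_, List.getElem?_eq_getElem (show d - 1 < w.len by omega)⟩
  by_cases hab : a = b
  · subst hab
    cases a with
    | true =>
      exact w.not_isBrickAlgebra_of_closed (by omega) (hlen ▸ hclosed) (hinj w hlen) hα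
        (by rwa [hlen]) hQ
    | false =>
      have hl : w.inv.len = d := w.len_inv.trans hlen
      refine w.inv.not_isBrickAlgebra_of_closed (α := β) (β := α) (by omega) ?_
        (hinj w.inv hl) ?_ ?_ hQ
      · rw [OString.vert_len, OString.endpt_inv, OString.vert_zero, ← w.vert_zero, hclosed,
          ← hlen, w.vert_len]
        rfl
      · rw [OString.getElem?_inv _ (by omega), hlen, Nat.sub_zero, hβ]
        rfl
      · rw [OString.getElem?_inv _ (by omega), hl, hlen, Nat.sub_self, hα]
        rfl
  · have hfol : Q.Follows (β, b) (α, a) := by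
      refine ⟨?_, ?_, fun h => hab (h.2.1.trans h.1.symm), fun h => hab (h.2.1.trans h.1.symm)⟩
      · rw [← OString.vert_succ_of_getElem? hβ, ← OString.vert_of_getElem? hα,
          Nat.sub_add_cancel hd0, hclosed]
      · intro h
        have h1 : w.vert 1 = w.vert (d - 1) := by
          rw [OString.vert_of_getElem? hβ, ← zero_add 1, OString.vert_succ_of_getElem? hα, h,
            ltgt_linv]
        rcases lt_trichotomy 1 (d - 1) with hlt | heq | hlt
        · have := hmin w 1 (d - 1) hlt (by omega) h1
          omega
        · rw [← heq] at hβ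
          refine (OString.follows_of_getElem? hα hβ).2.1 ?_
          rw [h, linv_linv]
        · obtain hd1 : d - 1 = 0 := by omega
          rw [hd1, hα] at hβ
          simp only [Option.some.injEq, Prod.mk.injEq] at hβ
          exact hab hβ.2
    have hdouble : ∀ l ∈ w.letters.getLast?, ∀ m ∈ w.letters.head?, Q.Follows l m := by
      intro l hl m hm
      rw [List.getLast?_eq_getElem?, Option.mem_def] at hl
      rw [List.head?_eq_getElem?, Option.mem_def, hα, Option.some.injEq] at hm
      have hl' : w.letters[d - 1]? = some l := by rw [← hlen]; exact hl
      rw [hβ, Option.some.injEq] at hl'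
      rwa [← hl', ← hm]
    set ww := w.double hdouble with hww
    have hwwl : ww.len = d + d := by
      simp only [OString.len] at hlen
      simp [hww, OString.double, OString.len, hlen]
    have hget : ∀ n < d, ww.letters[n]? = w.letters[n]? ∧
        ww.letters[n + d]? = w.letters[n]? := by
      intro n hn
      simp only [OString.len] at hlen
      simp only [hww, OString.double]
      constructor
      · rw [List.getElem?_append_left (by omega)]
      · rw [List.getElem?_append_right (by omega)]
        congr 1; omega
    -- The direct one of the two letters at the junction becomes the middle letter.
    have key : ∀ (s : ℕ) (γ : E), s ≤ 1 → ww.letters[s + (d - 1)]? = some (γ, true) → False := by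
      intro s γ hs hγ
      have hse : s + (d + d - 1) ≤ ww.len := by omega
      have hl : (ww.sub s (s + (d + d - 1))).len = d + d - 1 := by
        rw [OString.len_sub _ hse]; omega
      have hvert : ∀ n, n + d ≤ (ww.sub s (s + (d + d - 1))).len →
          (ww.sub s (s + (d + d - 1))).vert (n + d) = (ww.sub s (s + (d + d - 1))).vert n := by
        intro n hn
        rw [OString.vert_sub _ (by omega) hse, OString.vert_sub _ (by omega) hse, ← add_assoc,
          ← hlen]
        exact w.vert_double hdouble (by omega) (by omega)
      refine (ww.sub s (s + (d + d - 1))).not_isBrickAlgebra_of_periodic (d := d) (α := γ)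
        (by omega) ?_ ?_ hvert ?_ hQ
      · intro n hn
        rw [OString.getElem?_sub _ (by omega), OString.getElem?_sub _ (by omega), ← add_assoc,
          (hget (s + n) (by omega)).2, (hget (s + n) (by omega)).1]
      · rw [OString.getElem?_sub _ (by omega), hγ]
      · have aux : ∀ i j, i < j → j ≤ (ww.sub s (s + (d + d - 1))).len →
            (ww.sub s (s + (d + d - 1))).vert i = (ww.sub s (s + (d + d - 1))).vert j →
            i + d = j := by
          intro i j hij hj h
          have h1 := hmin _ i j hij hj h
          by_contra hne
          have h2 := hmin _ (i + d) j (by omega) hj (by rw [hvert i (by omega), h])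
          omega
        intro i j hi hj h
        rcases lt_trichotomy i j with hlt | heq | hlt
        · exact Or.inr (Or.inl (aux i j hlt hj h))
        · exact Or.inl heq
        · exact Or.inr (Or.inr (aux j i hlt hi h.symm))
    cases a with
    | true =>
      refine key 1 α le_rfl ?_
      rw [Nat.add_sub_cancel' hd0, ← zero_add d, (hget 0 hd0).2, hα]
    | false =>
      cases b with
      | false => exact hab rfl
      | true =>
        refine key 0 β (Nat.zero_le _) ?_
        rw [zero_add, (hget (d - 1) (by omega)).1, hβ]

end BoundQuiver

theorem mainTheorem4 {k : Type*} [Field k] {V : Type*} [Fintype V] {E : Type*} [Finite E]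
    (Q : BoundQuiver V E) (hconn : Q.IsConnected) (hgentle : Q.IsGentle)
    (hbrick : Q.IsBrickAlgebra k) :
    Set.BijOn (fun x : Q.Label => x.J) Set.univ
        {B : Set Q.Str | ∃ b : Q.Bic, IsJoinIrreducible b ∧ (b : Set Q.Str) = B} ∧
      ∀ F : Set Q.Label,
        (∃ 𝓕 ∈ canonicalJoinComplex Q.Bic,
            (fun b : Q.Bic => (b : Set Q.Str)) '' 𝓕 = (fun x : Q.Label => x.J) '' F) ↔
          ∀ x ∈ F, ∀ y ∈ F, x ≠ y →
            x.str ≠ y.str ∧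
            (¬ Q.IsProperConcatOf (x.J ∪ y.J) x.str ∧ ¬ Q.IsProperConcatOf (x.J ∪ y.J) y.str) ∧
            (¬ x.J ⊆ y.J ∧ ¬ y.J ⊆ x.J) :=
  hbrick.selfAvoiding.bijOn_J_and_face_iff
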